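/- Let $N\ge 1$ be an integer and $0<\lambda\le\Lambda$. For a real symmetric $N\times N$ matrix $M$ with eigenvalues $\mu_1,\dots,\mu_N$ (repeated with multiplicity) let $$\mathcal M^+(M)=\Lambda\sum_{\mu_i>0}\mu_i+\lambda\sum_{\mu_i<0}\mu_i$$ be Pucci's sup-operator. Set $$\tilde N_+=\frac{\lambda}{\Lambda}(N-1)+1,\qquad \tau=\frac{\tilde N_+-2}{2},\qquad \bar\lambda=\Lambda\tau^2,$$ and assume $0<\mu<\bar\lambda$ and $p>1$. Define $$\tau^\pm=\tau\pm\sqrt{\tau^2-\mu/\Lambda},\qquad p^\star=1+\frac{2}{\tau^+},\qquad p^{\star\star}=1+\frac{2}{\tau^-},$$ $$K=\Big[\Lambda\Big(\tfrac{2}{p-1}-\tau^+\Big)\Big(\tfrac{2}{p-1}-\tau^-\Big)\Big]^{\frac1{p-1}},\qquad \bar K=\big[\Lambda\tau^-(\tau-\tau^-)\big]^{\tau^- /2}.$$ A solution is a $C^\infty$, positive, radial function $u(x)=u(|x|)$ on $B_1\setminus\{0\}\subset\mathbb R^N$ satisfying, with $r=|x|$, $$\mathcal M^+(D^2u)+\mu\frac{u}{r^2}=u^p\quad\text{in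 }B_1\setminus\{0\}.$$ Then: 1. If $p<p^\star$, there are a solution $u$ with $r^{\frac{2}{p-1}}u(r)\to K$ as $r\to0^+$, a solution $v$ and a constant $c_1>0$ with $r^{\tau^+}v(r)\to c_1$ as $r\to0^+$, and a solution $w$ and a constant $c_2>0$ with $r^{\tau^-}w(r)\to c_2$ as $r\to0^+$. 2. If $p^\star\le p<p^{\star\star}$, there are a solution $u$ and a constant $c>0$ with $r^{\tau^-}u(r)\to c$ as $r\to0^+$. 3. If $p=p^{\star\star}$, there is a solution $u$ with $r^{\tau^-}(-\log r)^{\tau^- /2}u(r)\to\bar K$ as $r\to0^+$. 4. If $p>p^{\star\star}$, the function $u(r)=K\,r^{-\frac{2}{p-1}}$ is a solution; in particular there is a solution with $r^{\frac{2}{p-1}}u(r)\to K$ as $r\to0^+$. -/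

import Mathlib

open Set Filter Topology
open scoped ContDiff

noncomputable section

namespace PucciHardy

/-- Pucci's sup-operator `Λ ∑_{μ_i > 0} μ_i + λ ∑_{μ_i < 0} μ_i`, where the `μ_i` are the
eigenvalues, repeated with multiplicity, of the real symmetric matrix `M`. -/
def pucciSup {N : ℕ} (lam Lam : ℝ) {M : Matrix (Fin N) (Fin N) ℝ} (hM : M.IsHermitian) : ℝ :=
  Lam * ∑ i with 0 < hM.eigenvalues i, hM.eigenvalues i
    + lam * ∑ i with hM.eigenvalues i < 0, hM.eigenvalues i

/-- The matrix of second order partial derivatives `∂_i ∂_j U (x)`. -/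
def hessian {N : ℕ} (U : EuclideanSpace ℝ (Fin N) → ℝ) (x : EuclideanSpace ℝ (Fin N)) :
    Matrix (Fin N) (Fin N) ℝ :=
  Matrix.of fun i j =>
    fderiv ℝ (fun y => fderiv ℝ U y (EuclideanSpace.single j 1)) x (EuclideanSpace.single i 1)

/-- The punctured unit ball of `ℝ^N`. -/
def puncturedBall (N : ℕ) : Set (EuclideanSpace ℝ (Fin N)) := Metric.ball 0 1 \ {0}

/-- The radial function `x ↦ u |x|` is a smooth, positive solution of
`M⁺(D²U) + μ U / |x|² = U^p` in the punctured unit ball of `ℝ^N`. The Hessian matrix of a smooth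
function is symmetric; the proof `hM` of this symmetry only gives access to its eigenvalues. -/
structure IsSolution (N : ℕ) (lam Lam μ p : ℝ) (u : ℝ → ℝ) : Prop where
  smooth : ContDiffOn ℝ ∞ (fun x : EuclideanSpace ℝ (Fin N) => u ‖x‖) (puncturedBall N)
  pos : ∀ x ∈ puncturedBall N, 0 < u ‖x‖
  equation : ∀ x ∈ puncturedBall N,
    ∃ hM : (hessian (fun y : EuclideanSpace ℝ (Fin N) => u ‖y‖) x).IsHermitian,
      pucciSup lam Lam hM + μ * (u ‖x‖ / ‖x‖ ^ 2) = u ‖x‖ ^ p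

/-- The dimension-like parameter `Ñ₊ = (λ / Λ) (N - 1) + 1`. -/
def dimPlus (N : ℕ) (lam Lam : ℝ) : ℝ := lam / Lam * ((N : ℝ) - 1) + 1

/-- `τ = (Ñ₊ - 2) / 2`. -/
def tau (N : ℕ) (lam Lam : ℝ) : ℝ := (dimPlus N lam Lam - 2) / 2

/-- The principal eigenvalue `λ̄ = Λ τ²`. -/
def lamBar (N : ℕ) (lam Lam : ℝ) : ℝ := Lam * tau N lam Lam ^ 2

/-- `τ⁺ = τ + √(τ² - μ / Λ)`. -/
def tauPlus (N : ℕ) (lam Lam μ : ℝ) : ℝ :=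
  tau N lam Lam + Real.sqrt (tau N lam Lam ^ 2 - μ / Lam)

/-- `τ⁻ = τ - √(τ² - μ / Λ)`. -/
def tauMinus (N : ℕ) (lam Lam μ : ℝ) : ℝ :=
  tau N lam Lam - Real.sqrt (tau N lam Lam ^ 2 - μ / Lam)

/-- `p* = 1 + 2 / τ⁺`. -/
def pStar (N : ℕ) (lam Lam μ : ℝ) : ℝ := 1 + 2 / tauPlus N lam Lam μ

/-- `p** = 1 + 2 / τ⁻`. -/
def pStarStar (N : ℕ) (lam Lam μ : ℝ) : ℝ := 1 + 2 / tauMinus N lam Lam μ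

/-- `K = [Λ (2/(p-1) - τ⁺) (2/(p-1) - τ⁻)]^(1/(p-1))`. -/
def constK (N : ℕ) (lam Lam μ p : ℝ) : ℝ :=
  (Lam * (2 / (p - 1) - tauPlus N lam Lam μ) * (2 / (p - 1) - tauMinus N lam Lam μ))
    ^ (1 / (p - 1))

/-- `K̄ = [Λ τ⁻ (τ - τ⁻)]^(τ⁻/2)`. -/
def constKBar (N : ℕ) (lam Lam μ : ℝ) : ℝ :=
  (Lam * tauMinus N lam Lam μ * (tau N lam Lam - tauMinus N lam Lam μ))
    ^ (tauMinus N lam Lam μ / 2)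

end PucciHardy

end

open PucciHardy

/-! Where u' < 0 < u'', the Hessian of a radial function has the eigenvalue u'' once and u'/r with
multiplicity N − 1, so the fully nonlinear equation becomes the ODE Λu'' + λ(N−1)u'/r + μu/r² = u^p.
With u = r^(-σ) y(t) and t = -log r it reads y'' + 2(σ−τ)y' + (σ−τ⁺)(σ−τ⁻)y = Λ⁻¹ e^(-βt) y^p, where
β = 2 − σ(p−1) (`isSolution_of_emden`).

For σ = 2/(p−1), β vanishes and the constant K solves the equation as soon as the zero-order
coefficient is positive, which is the case below p* and above p**. For σ = τ⁺ or τ⁻ the zero-order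
term disappears and y should tend to a constant. At τ⁺ the first-order term is damping, so
integrating forward from t = 0 gives an increasing bounded y when β > 0 (`exists_fast_solution`). At
τ⁻ its sign is reversed and a typical solution grows like e^(2st) with s = τ − τ⁻; the growing mode
is removed by writing y' as an integral of the forcing over [t, ∞) (`exists_slow_solution`). If β >
0, then y'/y is integrable and the limit is positive. If β = 0, that is p = p**, then y' ~ -k
y^p/(2s) with k = 1/Λ, so y decays like a power of t, and this is the logarithmic factor
(`tendsto_rpow_mul_of_autonomous`).

Both constructions are contractions for a truncated nonlinearity. A small amplitude M gives the
contraction; it also keeps y inside the truncation range at τ⁺, and secures u' < 0 < u'' at τ⁻. -/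

open MeasureTheory

/-! ### The Pucci operator on radial functions -/

/-- If every eigenvalue of `M` is `a < 0` or `b > 0` and `b` is simple by the trace, then the Pucci
operator is `Λ b + λ (N - 1) a`. -/
theorem pucciSup_of_quadratic {N : ℕ} (lam Lam : ℝ) {M : Matrix (Fin N) (Fin N) ℝ}
    (hM : M.IsHermitian) {a b : ℝ} (ha : a < 0) (hb : 0 < b)
    (hquad : (M - a • (1 : Matrix (Fin N) (Fin N) ℝ)) * (M - b • (1 : Matrix (Fin N) (Fin N) ℝ)) = 0)
    (htr : M.trace = b + ((N : ℝ) - 1) * a) :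
    pucciSup lam Lam hM = Lam * b + lam * (((N : ℝ) - 1) * a) := by
  have hev : ∀ i, hM.eigenvalues i = a ∨ hM.eigenvalues i = b := by
    intro i
    set e := hM.eigenvalues i with he
    have h1 := hM.mulVec_eigenvectorBasis i
    set v : Fin N → ℝ := (hM.eigenvectorBasis i).ofLp with hv
    have hv0 : v ≠ 0 := by
      have := hM.eigenvectorBasis.orthonormal.ne_zero i
      intro h
      apply this
      ext j
      exact congrFun h j
    have h2 : ∀ c : ℝ, (M - c • (1 : Matrix (Fin N) (Fin N) ℝ)).mulVec v = (e - c) • v := by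
      intro c
      rw [Matrix.sub_mulVec, h1, Matrix.smul_mulVec, Matrix.one_mulVec, sub_smul]
    have h3 : ((e - b) * (e - a)) • v = 0 := by
      have := congrArg (fun A => A.mulVec v) hquad
      simp only [← Matrix.mulVec_mulVec, h2, Matrix.mulVec_smul, Matrix.zero_mulVec, smul_smul] at this
      exact this
    rcases smul_eq_zero.1 h3 with h | h
    · rcases mul_eq_zero.1 h with h | h
      · right; linarith
      · left; linarith
    · exact absurd h hv0
  have hsum : ∑ i, hM.eigenvalues i = b + ((N : ℝ) - 1) * a := by
    rw [← htr, hM.trace_eq_sum_eigenvalues]; simp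
  have hpos : ∑ i with 0 < hM.eigenvalues i, hM.eigenvalues i
      = (Finset.univ.filter fun i => 0 < hM.eigenvalues i).card * b := by
    rw [Finset.sum_congr rfl (g := fun _ => b), Finset.sum_const, nsmul_eq_mul]
    intro i hi
    have := (Finset.mem_filter.1 hi).2
    rcases hev i with h | h
    · linarith
    · exact h
  have hfil : (Finset.univ.filter fun i => ¬ 0 < hM.eigenvalues i)
      = Finset.univ.filter fun i => hM.eigenvalues i < 0 := by
    ext i
    simp only [Finset.mem_filter, Finset.mem_univ, true_and]
    rcases hev i with h | h
    · rw [h]; constructor <;> intro <;> linarith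
    · rw [h]; constructor <;> intro <;> linarith
  have hneg : ∑ i with hM.eigenvalues i < 0, hM.eigenvalues i
      = (Finset.univ.filter fun i => hM.eigenvalues i < 0).card * a := by
    rw [Finset.sum_congr rfl (g := fun _ => a), Finset.sum_const, nsmul_eq_mul]
    intro i hi
    have := (Finset.mem_filter.1 hi).2
    rcases hev i with h | h
    · exact h
    · linarith
  have hcard : ((Finset.univ.filter fun i => 0 < hM.eigenvalues i).card : ℝ)
      + (Finset.univ.filter fun i => hM.eigenvalues i < 0).card = N := by
    rw [← hfil]
    have := Finset.card_filter_add_card_filter_not (s := (Finset.univ : Finset (Fin N)))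
      (fun i => 0 < hM.eigenvalues i)
    rw [Finset.card_univ, Fintype.card_fin] at this
    exact_mod_cast this
  have hsplit := Finset.sum_filter_add_sum_filter_not (Finset.univ : Finset (Fin N))
      (fun i => 0 < hM.eigenvalues i) hM.eigenvalues
  rw [hfil, hpos, hneg, hsum] at hsplit
  unfold pucciSup
  rw [hpos, hneg]
  set m : ℝ := ((Finset.univ.filter fun i => 0 < hM.eigenvalues i).card : ℝ)
  set k : ℝ := ((Finset.univ.filter fun i => hM.eigenvalues i < 0).card : ℝ)
  -- The trace identity m b + (N − m) a = b + (N − 1) a forces m = 1, because a ≠ b.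
  have hm : m = 1 := by
    have : (m - 1) * (b - a) = 0 := by
      have : k = N - m := by linarith
      rw [this] at hsplit
      linarith
    rcases mul_eq_zero.1 this with h | h <;> linarith
  have hk : k = N - 1 := by linarith
  rw [hm, hk]
  ring

/-- The Hessian matrix of a radial function. -/
theorem hessian_radial {N : ℕ} {u u₁ u₂ : ℝ → ℝ}
    (h₁ : ∀ r ∈ Ioo (0 : ℝ) 1, HasDerivAt u (u₁ r) r)
    (h₂ : ∀ r ∈ Ioo (0 : ℝ) 1, HasDerivAt u₁ (u₂ r) r)
    {x : EuclideanSpace ℝ (Fin N)} (hx : x ∈ puncturedBall N) :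
    hessian (fun y : EuclideanSpace ℝ (Fin N) => u ‖y‖) x
      = (u₁ ‖x‖ / ‖x‖) • (1 : Matrix (Fin N) (Fin N) ℝ)
        + ((u₂ ‖x‖ - u₁ ‖x‖ / ‖x‖) / ‖x‖ ^ 2) • Matrix.vecMulVec x x := by
  have hmem : ∀ y ∈ puncturedBall N, ‖y‖ ∈ Ioo (0 : ℝ) 1 := fun y hy =>
    ⟨norm_pos_iff.2 hy.2, by simpa using hy.1⟩
  have hopen : IsOpen (puncturedBall N) := Metric.isOpen_ball.sdiff isClosed_singleton
  have hnorm : ∀ y ∈ puncturedBall N, HasFDerivAt (fun z : EuclideanSpace ℝ (Fin N) => ‖z‖)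
      ((1 / ‖y‖) • innerSL ℝ y) y := by
    intro y hy
    have h0 := (hmem y hy).1
    -- The norm is differentiated as the square root of its square, which is positive away from the
    -- origin.
    have h := ((hasStrictFDerivAt_norm_sq y).hasFDerivAt.sqrt (by positivity))
    have e : (fun z : EuclideanSpace ℝ (Fin N) => √(‖z‖ ^ 2)) = fun z => ‖z‖ := by
      ext z; rw [Real.sqrt_sq (norm_nonneg z)]
    rw [e, Real.sqrt_sq h0.le] at h
    refine h.congr_fderiv ?_
    ext z
    simp
    field_simp
  have hD : ∀ y ∈ puncturedBall N, ∀ j, fderiv ℝ (fun z : EuclideanSpace ℝ (Fin N) => u ‖z‖) y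
      (EuclideanSpace.single j 1) = (u₁ ‖y‖ / ‖y‖) * y j := by
    intro y hy j
    have h := (h₁ _ (hmem y hy)).comp_hasFDerivAt y (hnorm y hy)
    have h' : fderiv ℝ (fun z : EuclideanSpace ℝ (Fin N) => u ‖z‖) y
      = u₁ ‖y‖ • (1 / ‖y‖) • innerSL ℝ y := h.fderiv
    rw [h']
    simp [EuclideanSpace.inner_single_right]
    ring
  ext i j
  have hr := hmem x hx
  have hr0 : ‖x‖ ≠ 0 := hr.1.ne'
  have hev : (fun y => fderiv ℝ (fun z : EuclideanSpace ℝ (Fin N) => u ‖z‖) y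
      (EuclideanSpace.single j 1)) =ᶠ[𝓝 x] fun y => (u₁ ‖y‖ / ‖y‖) * y j :=
    eventually_of_mem (hopen.mem_nhds hx) fun y hy => hD y hy j
  have hq : HasDerivAt (fun r => u₁ r / r) ((u₂ ‖x‖ * ‖x‖ - u₁ ‖x‖ * 1) / ‖x‖ ^ 2) ‖x‖ :=
    (h₂ _ hr).div (hasDerivAt_id _) hr0
  have hq' : HasFDerivAt (fun y : EuclideanSpace ℝ (Fin N) => u₁ ‖y‖ / ‖y‖)
      (((u₂ ‖x‖ * ‖x‖ - u₁ ‖x‖ * 1) / ‖x‖ ^ 2) • (1 / ‖x‖) • innerSL ℝ x) x :=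
    hq.comp_hasFDerivAt x (hnorm x hx)
  have hpr : HasFDerivAt (fun y : EuclideanSpace ℝ (Fin N) => y j)
      (EuclideanSpace.proj j : EuclideanSpace ℝ (Fin N) →L[ℝ] ℝ) x :=
    (EuclideanSpace.proj j : EuclideanSpace ℝ (Fin N) →L[ℝ] ℝ).hasFDerivAt
  have hmul := hq'.mul hpr
  simp only [hessian, Matrix.of_apply]
  rw [hev.fderiv_eq]
  have : fderiv ℝ (fun y : EuclideanSpace ℝ (Fin N) => u₁ ‖y‖ / ‖y‖ * y j) x = _ := hmul.fderiv
  rw [this]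
  simp [EuclideanSpace.inner_single_right, Matrix.vecMulVec_apply, Matrix.one_apply]
  rcases eq_or_ne i j with rfl | hij
  · simp
    field_simp
  · simp [hij, Ne.symm hij]
    field_simp

/-- A radial function with `u' < 0 < u''` which satisfies the ordinary differential equation of the
problem is a solution. -/
theorem isSolution_of_radial {N : ℕ} {lam Lam μ p : ℝ} {u u₁ u₂ : ℝ → ℝ}
    (hsm : ContDiffOn ℝ ∞ u (Ioo 0 1)) (hpos : ∀ r ∈ Ioo (0 : ℝ) 1, 0 < u r)
    (h₁ : ∀ r ∈ Ioo (0 : ℝ) 1, HasDerivAt u (u₁ r) r)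
    (h₂ : ∀ r ∈ Ioo (0 : ℝ) 1, HasDerivAt u₁ (u₂ r) r)
    (hn : ∀ r ∈ Ioo (0 : ℝ) 1, u₁ r < 0) (hc : ∀ r ∈ Ioo (0 : ℝ) 1, 0 < u₂ r)
    (heq : ∀ r ∈ Ioo (0 : ℝ) 1,
      Lam * u₂ r + lam * (((N : ℝ) - 1) * (u₁ r / r)) + μ * (u r / r ^ 2) = u r ^ p) :
    IsSolution N lam Lam μ p u := by
  have hmem : ∀ y ∈ puncturedBall N, ‖y‖ ∈ Ioo (0 : ℝ) 1 := fun y hy =>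
    ⟨norm_pos_iff.2 hy.2, by simpa using hy.1⟩
  refine ⟨?_, fun x hx => hpos _ (hmem x hx), fun x hx => ?_⟩
  · exact hsm.comp (fun y hy => (contDiffAt_norm ℝ hy.2).contDiffWithinAt) hmem
  · have hr := hmem x hx
    have hr0 : ‖x‖ ≠ 0 := hr.1.ne'
    have hH := hessian_radial h₁ h₂ hx
    set A := hessian (fun y : EuclideanSpace ℝ (Fin N) => u ‖y‖) x
    set a := u₁ ‖x‖ / ‖x‖
    set b := u₂ ‖x‖
    have hxx : x.ofLp ⬝ᵥ x.ofLp = ‖x‖ ^ 2 := by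
      rw [EuclideanSpace.real_norm_sq_eq]
      simp [dotProduct, sq]
    have hM : A.IsHermitian := by
      rw [hH]
      ext i j
      simp [Matrix.vecMulVec_apply, Matrix.one_apply, eq_comm, mul_comm]
    refine ⟨hM, ?_⟩
    rw [pucciSup_of_quadratic lam Lam hM (a := a) (b := b)
      (div_neg_of_neg_of_pos (hn _ hr) hr.1) (hc _ hr) ?_ ?_]
    · exact heq _ hr
    -- A − a is a multiple of P = x xᵀ and P² = ‖x‖² P, so the product with A − b is a multiple of
    -- (a + (b − a) − b) P = 0.
    · rw [hH, add_sub_cancel_left, smul_mul_assoc]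
      have : Matrix.vecMulVec x.ofLp x.ofLp * Matrix.vecMulVec x.ofLp x.ofLp
          = ‖x‖ ^ 2 • Matrix.vecMulVec x.ofLp x.ofLp := by
        rw [Matrix.vecMulVec_mul_vecMulVec, hxx]
        ext i j
        simp [Matrix.vecMulVec_apply]
        ring
      rw [mul_sub, mul_add, mul_smul_comm, mul_smul_comm, mul_smul_comm, mul_one, this, smul_smul,
        ← add_smul, ← sub_smul]
      have h0 : a + (b - a) / ‖x‖ ^ 2 * ‖x‖ ^ 2 - b = 0 := by field_simp; ring
      rw [h0, zero_smul, smul_zero]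
    · rw [hH, Matrix.trace_add, Matrix.trace_smul, Matrix.trace_smul, Matrix.trace_one,
        Matrix.trace_vecMulVec, hxx, Fintype.card_fin]
      simp only [smul_eq_mul]
      field_simp
      ring

/-! ### Emden–Fowler variables -/

/-- The derivative has the same shape with σ + 1 in place of σ, so a second application yields u''.
-/
theorem hasDerivAt_rpow_mul_comp_neg_log {σ r g' : ℝ} {g : ℝ → ℝ} (hr : 0 < r)
    (hg : HasDerivAt g g' (-Real.log r)) :
    HasDerivAt (fun r => r ^ (-σ) * g (-Real.log r))
      (-(r ^ (-(σ + 1)) * (σ * g (-Real.log r) + g'))) r := by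
  have h1 : HasDerivAt (fun r : ℝ => r ^ (-σ)) (-σ * r ^ (-σ - 1)) r :=
    Real.hasDerivAt_rpow_const (Or.inl hr.ne')
  have h2 : HasDerivAt (fun r => g (-Real.log r)) (g' * (-r⁻¹)) r :=
    hg.comp r (Real.hasDerivAt_log hr.ne').neg
  refine (h1.mul h2).congr_deriv ?_
  have h3 : r ^ (-σ) = r ^ (-(σ + 1)) * r := by
    rw [← Real.rpow_add_one hr.ne']; congr 1; ring
  rw [show -σ - 1 = -(σ + 1) by ring, h3]
  field_simp
  ring

/-- Emden–Fowler change of variables `u(r) = r ^ (-σ) y(-log r)`. -/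
theorem isSolution_of_emden {N : ℕ} {lam Lam μ p σ : ℝ} (hLam : Lam ≠ 0) {y y₁ y₂ : ℝ → ℝ}
    (hsm : ContDiffOn ℝ ∞ y (Ioi 0)) (hpos : ∀ t > 0, 0 < y t)
    (h₁ : ∀ t > 0, HasDerivAt y (y₁ t) t) (h₂ : ∀ t > 0, HasDerivAt y₁ (y₂ t) t)
    (hn : ∀ t > 0, 0 < σ * y t + y₁ t)
    (hc : ∀ t > 0, 0 < σ * (σ + 1) * y t + (2 * σ + 1) * y₁ t + y₂ t)
    (heq : ∀ t > 0, Lam * (y₂ t + 2 * (σ - tau N lam Lam) * y₁ t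
      + (σ ^ 2 - 2 * tau N lam Lam * σ + μ / Lam) * y t)
        = Real.exp (-(2 - σ * (p - 1)) * t) * y t ^ p) :
    IsSolution N lam Lam μ p (fun r => r ^ (-σ) * y (-Real.log r)) := by
  have hT : ∀ r ∈ Ioo (0 : ℝ) 1, 0 < -Real.log r := fun r hr =>
    neg_pos.2 (Real.log_neg hr.1 hr.2)
  refine isSolution_of_radial
    (u₁ := fun r => -(r ^ (-(σ + 1)) * (σ * y (-Real.log r) + y₁ (-Real.log r))))
    (u₂ := fun r => r ^ (-(σ + 1 + 1)) *
      (σ * (σ + 1) * y (-Real.log r) + (2 * σ + 1) * y₁ (-Real.log r) + y₂ (-Real.log r)))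
    ?_ ?_ ?_ ?_ ?_ ?_ ?_
  · refine ContDiffOn.mul (fun r hr => ?_) ?_
    · exact (Real.contDiffAt_rpow_const_of_ne hr.1.ne').contDiffWithinAt
    · exact hsm.comp (fun r hr => (Real.contDiffAt_log.2 hr.1.ne').neg.contDiffWithinAt) hT
  · exact fun r hr => mul_pos (Real.rpow_pos_of_pos hr.1 _) (hpos _ (hT r hr))
  · exact fun r hr => hasDerivAt_rpow_mul_comp_neg_log hr.1 (h₁ _ (hT r hr))
  · intro r hr
    have h := (hasDerivAt_rpow_mul_comp_neg_log (σ := σ + 1) (g := fun t => σ * y t + y₁ t) hr.1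
      (((h₁ _ (hT r hr)).const_mul σ).add (h₂ _ (hT r hr)))).neg
    refine h.congr_deriv ?_
    ring
  · exact fun r hr => neg_neg_of_pos (mul_pos (Real.rpow_pos_of_pos hr.1 _) (hn _ (hT r hr)))
  · exact fun r hr => mul_pos (Real.rpow_pos_of_pos hr.1 _) (hc _ (hT r hr))
  · intro r hr
    have ht := hT r hr
    have h := heq _ ht
    have hr0 := hr.1
    set t := -Real.log r
    have hrt : r = Real.exp (-t) := by simp [t, Real.exp_log hr0]
    -- This is λ(N − 1) = Λ(Ñ₊ − 1); it eliminates λ and N in favour of Λ and τ.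
    have hlam : lam * ((N : ℝ) - 1) = Lam * (2 * tau N lam Lam + 1) := by
      unfold tau dimPlus; field_simp; ring
    have e1 : r ^ (-σ) = r ^ (-(σ + 1 + 1)) * r ^ 2 := by
      rw [← Real.rpow_natCast, ← Real.rpow_add hr0]; congr 1; push_cast; ring
    have e2 : r ^ (-(σ + 1)) = r ^ (-(σ + 1 + 1)) * r := by
      rw [← Real.rpow_add_one hr0.ne']; congr 1; ring
    have e3 : (r ^ (-σ) * y t) ^ p
        = r ^ (-(σ + 1 + 1)) * (Real.exp (-(2 - σ * (p - 1)) * t) * y t ^ p) := by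
      rw [Real.mul_rpow (Real.rpow_nonneg hr0.le _) (hpos t ht).le, ← mul_assoc]
      congr 1
      rw [hrt, ← Real.exp_mul, ← Real.exp_mul, ← Real.exp_mul, ← Real.exp_add]
      congr 1
      ring
    rw [e3, ← h, ← mul_assoc lam, hlam, e2, e1]
    field_simp
    ring

/-- Bootstrap of the regularity of the solutions of the Emden–Fowler system. -/
theorem contDiffOn_of_emden_system {a β k p : ℝ} {y z : ℝ → ℝ} (hpos : ∀ t > 0, 0 < y t)
    (hy : ∀ t > 0, HasDerivAt y (z t) t)
    (hz : ∀ t > 0, HasDerivAt z (a * z t + Real.exp (-β * t) * (k * y t ^ p)) t) :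
    ContDiffOn ℝ ∞ y (Ioi 0) := by
  -- Both components gain regularity together; y ^ p is as smooth as y because y stays positive.
  have key : ∀ n : ℕ, ContDiffOn ℝ n y (Ioi 0) ∧ ContDiffOn ℝ n z (Ioi 0) := by
    intro n
    induction n with
    | zero =>
      simp only [Nat.cast_zero, contDiffOn_zero]
      exact ⟨fun t ht => (hy t ht).continuousAt.continuousWithinAt,
        fun t ht => (hz t ht).continuousAt.continuousWithinAt⟩
    | succ n ih =>
      push_cast
      rw [contDiffOn_succ_iff_deriv_of_isOpen isOpen_Ioi,
        contDiffOn_succ_iff_deriv_of_isOpen isOpen_Ioi]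
      refine ⟨⟨fun t ht => (hy t ht).differentiableAt.differentiableWithinAt, by simp, ?_⟩,
        fun t ht => (hz t ht).differentiableAt.differentiableWithinAt, by simp, ?_⟩
      · exact ih.2.congr fun t ht => (hy t ht).deriv
      · refine ContDiffOn.congr ?_ fun t ht => (hz t ht).deriv
        refine (contDiffOn_const.mul ih.2).add (ContDiffOn.mul ?_ (contDiffOn_const.mul ?_))
        · exact (contDiff_const.mul contDiff_id).exp.contDiffOn
        · exact ih.1.rpow_const_of_ne fun t ht => (hpos t ht).ne'
  exact contDiffOn_infty.2 fun n => (key n).1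

/-! ### Contraction in an exponentially weighted norm -/

/-- A fixed point theorem on `[0, ∞)` for operators which contract the norm
`sup exp (-s t) |y t|`. -/
theorem exists_fixedPoint_of_weighted_contraction {s : ℝ} {Φ : (ℝ → ℝ) → ℝ → ℝ}
    (hcont : ∀ y, Continuous y → Continuous (Φ y))
    (hbdd : ∀ y, Continuous y → ∃ C, ∀ t ≥ 0, |Φ y t| ≤ C * Real.exp (s * t))
    (hlip : ∀ y₁ y₂ : ℝ → ℝ, ∀ C, Continuous y₁ → Continuous y₂ →
      (∀ t ≥ 0, |y₁ t - y₂ t| ≤ C * Real.exp (s * t)) →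
      ∀ t ≥ 0, |Φ y₁ t - Φ y₂ t| ≤ C / 2 * Real.exp (s * t)) :
    ∃ y : ℝ → ℝ, Continuous y ∧ ∀ t ≥ 0, y t = Φ y t := by
  -- Division by the weight reduces to bounded functions with the sup norm. Freezing the argument at
  -- `max t 0` makes everything depend on the half-line only, while functions stay continuous on ℝ.
  let lift : BoundedContinuousFunction ℝ ℝ → ℝ → ℝ := fun Y t =>
    Real.exp (s * max t 0) * Y (max t 0)
  have hlift : ∀ Y, Continuous (lift Y) := fun Y => by
    have := Y.continuous
    fun_prop
  have hmax : Continuous fun t : ℝ => max t 0 := by fun_prop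
  have hpb : ∀ Y : BoundedContinuousFunction ℝ ℝ, ∃ C, ∀ t : ℝ,
      ‖Real.exp (-(s * max t 0)) * Φ (lift Y) (max t 0)‖ ≤ C := by
    intro Y
    obtain ⟨C, hC⟩ := hbdd _ (hlift Y)
    refine ⟨C, fun t => ?_⟩
    rw [Real.norm_eq_abs, abs_mul, Real.abs_exp]
    calc _ ≤ Real.exp (-(s * max t 0)) * (C * Real.exp (s * max t 0)) := by
          gcongr
          exact hC _ (le_max_right _ _)
      _ = C * (Real.exp (-(s * max t 0)) * Real.exp (s * max t 0)) := by ring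
      _ = C := by rw [← Real.exp_add]; simp
  choose C hC using hpb
  let Ψ : BoundedContinuousFunction ℝ ℝ → BoundedContinuousFunction ℝ ℝ := fun Y =>
    BoundedContinuousFunction.ofNormedAddCommGroup
      (fun t => Real.exp (-(s * max t 0)) * Φ (lift Y) (max t 0))
      (by
        have h1 := (hcont _ (hlift Y)).comp hmax
        have h2 : Continuous fun t : ℝ => Real.exp (-(s * max t 0)) := by fun_prop
        exact h2.mul h1) (C Y) (hC Y)
  have hΨ : ContractingWith (1 / 2) Ψ := by
    refine ⟨by norm_num [← NNReal.coe_lt_coe], LipschitzWith.of_dist_le_mul fun Y₁ Y₂ => ?_⟩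
    rw [BoundedContinuousFunction.dist_le (by positivity)]
    intro t
    have ht := le_max_right t 0
    have hd : ∀ t ≥ 0, |lift Y₁ t - lift Y₂ t| ≤ dist Y₁ Y₂ * Real.exp (s * t) := by
      intro t ht
      have hY : |Y₁ t - Y₂ t| ≤ dist Y₁ Y₂ := by
        rw [← Real.dist_eq]
        exact BoundedContinuousFunction.dist_coe_le_dist (f := Y₁) (g := Y₂) t
      simp only [lift, max_eq_left ht]
      rw [← mul_sub, abs_mul, Real.abs_exp, mul_comm]
      gcongr
    have h := hlip (lift Y₁) (lift Y₂) (dist Y₁ Y₂) (hlift Y₁) (hlift Y₂) hd _ ht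
    simp only [Ψ, BoundedContinuousFunction.coe_ofNormedAddCommGroup]
    rw [Real.dist_eq, ← mul_sub, abs_mul, Real.abs_exp]
    calc _ ≤ Real.exp (-(s * max t 0)) * (dist Y₁ Y₂ / 2 * Real.exp (s * max t 0)) := by gcongr
      _ = dist Y₁ Y₂ / 2 * (Real.exp (-(s * max t 0)) * Real.exp (s * max t 0)) := by ring
      _ = dist Y₁ Y₂ / 2 := by rw [← Real.exp_add]; simp
      _ ≤ _ := by push_cast; linarith
  obtain ⟨Y, hY⟩ : ∃ Y, Ψ Y = Y := ⟨_, hΨ.fixedPoint_isFixedPt⟩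
  refine ⟨lift Y, hlift Y, fun t ht => ?_⟩
  have h : Ψ Y t = Y t := by rw [hY]
  simp only [Ψ, BoundedContinuousFunction.coe_ofNormedAddCommGroup, max_eq_left ht] at h
  have h' : lift Y t = Real.exp (s * t) * Y t := by
    simp only [lift, max_eq_left ht]
  rw [h', ← h, ← mul_assoc, ← Real.exp_add]
  simp

/-! ### The truncated nonlinearity -/

/-- The power nonlinearity `k y ^ p` truncated outside of `[0, M]`. -/
noncomputable def truncPow (k p M y : ℝ) : ℝ := k * (max (min y M) 0) ^ p

theorem continuous_truncPow {k p M : ℝ} (hp : 0 ≤ p) : Continuous (truncPow k p M) := by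
  unfold truncPow
  exact continuous_const.mul
    (((continuous_id.min continuous_const).max continuous_const).rpow_const fun _ => Or.inr hp)

theorem truncPow_nonneg {k p M : ℝ} (hk : 0 ≤ k) (y : ℝ) : 0 ≤ truncPow k p M y :=
  mul_nonneg hk (Real.rpow_nonneg (le_max_right _ _) _)

theorem truncPow_eq {k p M y : ℝ} (h0 : 0 ≤ y) (hM : y ≤ M) : truncPow k p M y = k * y ^ p := by
  rw [truncPow, min_eq_left hM, max_eq_left h0]

theorem truncPow_le {k p M : ℝ} (hk : 0 ≤ k) (hp : 0 ≤ p) (hM : 0 ≤ M) (y : ℝ) :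
    truncPow k p M y ≤ k * M ^ p := by
  unfold truncPow
  gcongr
  exact max_le (min_le_right _ _) hM

theorem truncPow_mono {k p M : ℝ} (hk : 0 ≤ k) (hp : 0 ≤ p) : Monotone (truncPow k p M) := by
  intro x y h
  unfold truncPow
  gcongr

/-- Superlinearity gives a linear bound whose slope is small with M; it drives the Gronwall argument
for positivity. -/
theorem truncPow_le_linear {k p M y : ℝ} (hk : 0 ≤ k) (hp : 1 < p) (hM : 0 ≤ M) (hy : 0 ≤ y) :
    truncPow k p M y ≤ k * M ^ (p - 1) * y := by
  have h0 : 0 ≤ min y M := le_min hy hM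
  rw [truncPow, max_eq_left h0, mul_assoc]
  gcongr
  calc (min y M) ^ p = (min y M) ^ (p - 1) * min y M := by
        conv_rhs => rw [← Real.rpow_add_one' h0 (by linarith), sub_add_cancel]
    _ ≤ M ^ (p - 1) * y := by
        gcongr
        · exact min_le_right _ _
        · exact min_le_left _ _

/-- Clamping to [0, M] is 1-Lipschitz, and on [0, M] the derivative of z ^ p is at most p M ^ (p −
1). -/
theorem abs_truncPow_sub_le {k p M : ℝ} (hk : 0 ≤ k) (hp : 1 < p) (hM : 0 ≤ M) (x y : ℝ) :
    |truncPow k p M x - truncPow k p M y| ≤ k * p * M ^ (p - 1) * |x - y| := by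
  unfold truncPow
  have hmem : ∀ z : ℝ, max (min z M) 0 ∈ Icc (0 : ℝ) M := fun z =>
    ⟨le_max_right _ _, max_le (min_le_right _ _) hM⟩
  have h1 := (convex_Icc (0 : ℝ) M).norm_image_sub_le_of_norm_hasDerivWithin_le
    (f := fun z : ℝ => z ^ p) (f' := fun z : ℝ => p * z ^ (p - 1)) (C := p * M ^ (p - 1))
    (fun z _ => (Real.hasDerivAt_rpow_const (Or.inr hp.le)).hasDerivWithinAt)
    (fun z hz => by
      rw [Real.norm_eq_abs, abs_of_nonneg (mul_nonneg (by linarith) (Real.rpow_nonneg hz.1 _))]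
      have := hz.1
      gcongr
      exact hz.2) (hmem y) (hmem x)
  have h2 : |max (min x M) 0 - max (min y M) 0| ≤ |x - y| :=
    (abs_max_sub_max_le_abs _ _ _).trans
      ((abs_min_sub_min_le_max x M y M).trans (by simp))
  rw [Real.norm_eq_abs, Real.norm_eq_abs] at h1
  have hMp : 0 ≤ M ^ (p - 1) := Real.rpow_nonneg hM _
  rw [← mul_sub, abs_mul, abs_of_nonneg hk]
  calc _ ≤ k * (p * M ^ (p - 1) * |max (min x M) 0 - max (min y M) 0|) := by gcongr
    _ ≤ k * (p * M ^ (p - 1) * |x - y|) := by gcongr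
    _ = _ := by ring

/-! ### The resolvent integral over [t, ∞) -/

/-- The bounded solution `∫_t^∞ exp (-a (τ - t)) G τ dτ` of `q' = a q - G`. -/
noncomputable def expResolvent (a : ℝ) (G : ℝ → ℝ) (t : ℝ) : ℝ :=
  ∫ h in Ioi (0 : ℝ), Real.exp (-a * h) * G (t + h)

theorem integrableOn_exp_mul_of_bounded {a B : ℝ} (ha : 0 < a) {G : ℝ → ℝ} (hG : Continuous G)
    (hB : ∀ t, |G t| ≤ B) (c : ℝ) : IntegrableOn (fun h => Real.exp (-a * h) * G h) (Ioi c) :=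
  (integrableOn_exp_mul_Ioi (neg_lt_zero.2 ha) c).mul_bdd hG.aestronglyMeasurable
    (Eventually.of_forall hB)

/-- Against the kernel e^(-ah), growth e^(bh) integrates to 1/(a − b). The rate b is 0 for plain
bounds, positive for the contraction, and negative in the sharp lower bound on y'. -/
theorem expResolvent_le {a b A B t : ℝ} (ha : 0 < a) (hb : b < a) {G : ℝ → ℝ} (hG : Continuous G)
    (hB : ∀ t, |G t| ≤ B) (h : ∀ h > 0, G (t + h) ≤ A * Real.exp (b * h)) :
    expResolvent a G t ≤ A / (a - b) := by
  have h1 : ∫ h in Ioi (0 : ℝ), A * Real.exp ((b - a) * h) = A / (a - b) := by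
    rw [integral_const_mul, integral_exp_mul_Ioi (sub_neg.2 hb)]
    simp only [mul_zero, Real.exp_zero]
    rw [← neg_sub a b, neg_div_neg_eq, mul_one_div]
  rw [← h1]
  refine setIntegral_mono_on
    (integrableOn_exp_mul_of_bounded ha (hG.comp (continuous_const.add continuous_id))
      (fun s => hB (t + s)) 0)
    ((integrableOn_exp_mul_Ioi (sub_neg.2 hb) 0).const_mul A) measurableSet_Ioi fun x hx => ?_
  calc _ ≤ Real.exp (-a * x) * (A * Real.exp (b * x)) := by gcongr; exact h x hx
    _ = A * (Real.exp (-a * x) * Real.exp (b * x)) := by ring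
    _ = _ := by rw [← Real.exp_add]; congr 2; ring

theorem expResolvent_neg (a : ℝ) (G : ℝ → ℝ) (t : ℝ) :
    expResolvent a (fun x => -G x) t = -expResolvent a G t := by
  simp only [expResolvent, mul_neg, integral_neg]

theorem le_expResolvent {a b A B t : ℝ} (ha : 0 < a) (hb : b < a) {G : ℝ → ℝ} (hG : Continuous G)
    (hB : ∀ t, |G t| ≤ B) (h : ∀ h > 0, A * Real.exp (b * h) ≤ G (t + h)) :
    A / (a - b) ≤ expResolvent a G t := by
  have := expResolvent_le (A := -A) (G := fun x => -G x) (t := t) ha hb hG.neg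
    (fun t => by rw [abs_neg]; exact hB t) (fun x hx => by linarith [h x hx])
  rw [expResolvent_neg, neg_div] at this
  linarith

theorem abs_expResolvent_sub_le {a b A B t : ℝ} (ha : 0 < a) (hb : b < a) {G₁ G₂ : ℝ → ℝ}
    (hG₁ : Continuous G₁) (hG₂ : Continuous G₂) (hB₁ : ∀ t, |G₁ t| ≤ B) (hB₂ : ∀ t, |G₂ t| ≤ B)
    (h : ∀ h > 0, |G₁ (t + h) - G₂ (t + h)| ≤ A * Real.exp (b * h)) :
    |expResolvent a G₁ t - expResolvent a G₂ t| ≤ A / (a - b) := by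
  have hsub : expResolvent a G₁ t - expResolvent a G₂ t = expResolvent a (fun x => G₁ x - G₂ x) t := by
    unfold expResolvent
    rw [← integral_sub]
    · simp only [mul_sub]
    · exact integrableOn_exp_mul_of_bounded ha (hG₁.comp (continuous_const.add continuous_id))
        (fun s => hB₁ (t + s)) 0
    · exact integrableOn_exp_mul_of_bounded ha (hG₂.comp (continuous_const.add continuous_id))
        (fun s => hB₂ (t + s)) 0
  have hbd : ∀ t, |G₁ t - G₂ t| ≤ B + B := fun t =>
    (abs_sub _ _).trans (add_le_add (hB₁ t) (hB₂ t))
  rw [hsub, abs_le]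
  constructor
  · have := le_expResolvent (A := -A) (G := fun x => G₁ x - G₂ x) (t := t) ha hb (hG₁.sub hG₂) hbd
      (fun x hx => by linarith [(abs_le.1 (h x hx)).1])
    rwa [neg_div] at this
  · exact expResolvent_le ha hb (hG₁.sub hG₂) hbd fun x hx => (abs_le.1 (h x hx)).2

/-- Substituting x = t + h gives e^(at) ∫_t^∞ e^(-ax) G(x) dx. Splitting off the integral over [0,
t] leaves a constant, and the fundamental theorem of calculus applies. -/
theorem hasDerivAt_expResolvent {a B : ℝ} (ha : 0 < a) {G : ℝ → ℝ} (hG : Continuous G)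
    (hB : ∀ t, |G t| ≤ B) (t : ℝ) :
    HasDerivAt (expResolvent a G) (a * expResolvent a G t - G t) t := by
  have hgc : Continuous fun x => Real.exp (-a * x) * G x := by fun_prop
  have hI := integrableOn_exp_mul_of_bounded ha hG hB
  have hform : ∀ t, expResolvent a G t = Real.exp (a * t) *
      ((∫ x in Ioi (0 : ℝ), Real.exp (-a * x) * G x) - ∫ x in (0 : ℝ)..t, Real.exp (-a * x) * G x) := by
    intro t
    have h1 := intervalIntegral.integral_interval_add_Ioi (hI 0) (hI t)
    rw [← h1, add_sub_cancel_left]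
    have h2 := (measurePreserving_add_left volume t).setIntegral_preimage_emb
      (measurableEmbedding_addLeft t) (fun x => Real.exp (-a * x) * G x) (Ioi t)
    have h3 : (fun x => t + x) ⁻¹' Ioi t = Ioi 0 := by ext; simp
    rw [← h2, h3, ← integral_const_mul, expResolvent]
    congr 1
    ext x
    rw [← mul_assoc, ← Real.exp_add]
    congr 2
    ring
  have hd := ((((hasDerivAt_id t).const_mul a).exp).mul
    ((hgc.integral_hasStrictDerivAt 0 t).hasDerivAt.const_sub
      (∫ x in Ioi (0 : ℝ), Real.exp (-a * x) * G x)))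
  have hfun : expResolvent a G = _ := funext hform
  rw [hform t]
  conv => arg 1; rw [hfun]
  refine hd.congr_deriv ?_
  have he : Real.exp (a * t) * Real.exp (-a * t) = 1 := by rw [← Real.exp_add]; simp
  simp only [id, mul_one]
  linear_combination (-G t) * he

/-! ### Nonlocal first-order equations -/

/-- Solvability of `y' = W y`, `y 0 = y₀` for a nonlocal operator `W` with a small Lipschitz
constant in a weighted norm. -/
theorem exists_nonlocal_solution {s B : ℝ} (hs : 0 < s) (y₀ : ℝ) {W : (ℝ → ℝ) → ℝ → ℝ}
    (hcont : ∀ y, Continuous y → Continuous (W y))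
    (hbdd : ∀ y, Continuous y → ∀ t ≥ 0, |W y t| ≤ B)
    (hlip : ∀ y₁ y₂ : ℝ → ℝ, ∀ C, Continuous y₁ → Continuous y₂ →
      (∀ t ≥ 0, |y₁ t - y₂ t| ≤ C * Real.exp (s * t)) →
      ∀ t ≥ 0, |W y₁ t - W y₂ t| ≤ s * C / 2 * Real.exp (s * t)) :
    ∃ y : ℝ → ℝ, Continuous y ∧ y 0 = y₀ ∧ ∀ t > 0, HasDerivAt y (W y t) t := by
  obtain ⟨y, hy, hfix⟩ : ∃ y : ℝ → ℝ, Continuous y ∧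
      ∀ t ≥ 0, y t = y₀ + ∫ x in (0 : ℝ)..t, W y x := by
    refine exists_fixedPoint_of_weighted_contraction (s := s)
      (Φ := fun y t => y₀ + ∫ x in (0 : ℝ)..t, W y x) ?_ ?_ ?_
    · intro y hy
      exact continuous_const.add (intervalIntegral.continuous_primitive
        (fun a b => (hcont y hy).intervalIntegrable a b) 0)
    · intro y hy
      refine ⟨|y₀| + B / s, fun t ht => ?_⟩
      have hB : 0 ≤ B := (abs_nonneg _).trans (hbdd y hy 0 le_rfl)
      have h1 : |∫ x in (0 : ℝ)..t, W y x| ≤ B * t := by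
        have := intervalIntegral.norm_integral_le_of_norm_le_const (a := 0) (b := t) (C := B)
          (f := W y) fun x hx => hbdd y hy x (by rw [uIoc_of_le ht] at hx; exact hx.1.le)
        rwa [sub_zero, abs_of_nonneg ht] at this
      -- The primitive of a bounded function grows at most linearly, which the weight absorbs.
      have h2 : s * t + 1 ≤ Real.exp (s * t) := Real.add_one_le_exp _
      have h3 : 0 ≤ s * t := by positivity
      calc |y₀ + ∫ x in (0 : ℝ)..t, W y x| ≤ |y₀| + B * t :=
            (abs_add_le _ _).trans (add_le_add le_rfl h1)
        _ = |y₀| * 1 + B / s * (s * t) := by field_simp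
        _ ≤ |y₀| * Real.exp (s * t) + B / s * Real.exp (s * t) := by
            gcongr <;> linarith
        _ = _ := by ring
    · intro y₁ y₂ C h₁ h₂ hd t ht
      have hC : 0 ≤ C := by
        have := (abs_nonneg _).trans (hd 0 le_rfl)
        simpa using this
      have hi : ∀ y, Continuous y → IntervalIntegrable (W y) volume 0 t := fun y hy =>
        (hcont y hy).intervalIntegrable 0 t
      simp only [add_sub_add_left_eq_sub]
      rw [← intervalIntegral.integral_sub (hi _ h₁) (hi _ h₂)]
      have hle := intervalIntegral.norm_integral_le_of_norm_le (f := fun x => W y₁ x - W y₂ x)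
        (g := fun x => s * C / 2 * Real.exp (s * x)) (μ := volume) ht
        (Eventually.of_forall fun x hx => hlip y₁ y₂ C h₁ h₂ hd x hx.1.le)
        (by apply Continuous.intervalIntegrable; fun_prop)
      -- Integrating e^(sx) gains a factor 1/s, which cancels the s in the Lipschitz bound on W and
      -- leaves C/2.
      have hint : ∫ x in (0 : ℝ)..t, s * C / 2 * Real.exp (s * x)
          = C / 2 * Real.exp (s * t) - C / 2 * Real.exp (s * 0) := by
        refine intervalIntegral.integral_eq_sub_of_hasDerivAt
          (f := fun x => C / 2 * Real.exp (s * x)) (fun x _ => ?_)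
          (by apply Continuous.intervalIntegrable; fun_prop)
        exact ((((hasDerivAt_id x).const_mul s).exp).const_mul (C / 2)).congr_deriv (by simp; ring)
      rw [hint] at hle
      refine hle.trans ?_
      simp
      linarith
  refine ⟨y, hy, by simpa using hfix 0 le_rfl, fun t ht => ?_⟩
  refine (((hcont y hy).integral_hasStrictDerivAt 0 t).hasDerivAt.const_add y₀).congr_of_eventuallyEq ?_
  filter_upwards [lt_mem_nhds ht] with x hx using hfix x hx.le

/-- A one-sided Gronwall inequality, with integrating factor e^(cx). -/
theorem exp_mul_le_exp_mul_of_deriv {y q : ℝ → ℝ} {a b c : ℝ} (hab : a ≤ b) (hy : Continuous y)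
    (hd : ∀ x ∈ Ioo a b, HasDerivAt y (-q x) x) (hq : ∀ x ∈ Ioo a b, q x ≤ c * y x) :
    Real.exp (c * a) * y a ≤ Real.exp (c * b) * y b := by
  have hmono : MonotoneOn (fun x => Real.exp (c * x) * y x) (Icc a b) := by
    have hD : ∀ x ∈ Ioo a b, HasDerivAt (fun x => Real.exp (c * x) * y x)
        (Real.exp (c * x) * (c * y x - q x)) x := fun x hx =>
      ((((hasDerivAt_id x).const_mul c).exp).mul (hd x hx)).congr_deriv (by simp; ring)
    refine monotoneOn_of_deriv_nonneg (convex_Icc a b) (by fun_prop) ?_ ?_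
    · rw [interior_Icc]
      exact fun x hx => (hD x hx).differentiableAt.differentiableWithinAt
    · rw [interior_Icc]
      intro x hx
      rw [(hD x hx).deriv]
      exact mul_nonneg (Real.exp_pos _).le (by linarith [hq x hx])
  exact hmono (left_mem_Icc.2 hab) (right_mem_Icc.2 hab) hab

/-! ### The slow solution, for the exponent τ⁻ -/

/-- The nonlinearity of the truncated Emden–Fowler equation along `y`. -/
noncomputable def forcing (β k p M : ℝ) (y : ℝ → ℝ) (t : ℝ) : ℝ :=
  Real.exp (-β * max t 0) * truncPow k p M (y t)

theorem continuous_forcing {β k p M : ℝ} (hp : 0 ≤ p) {y : ℝ → ℝ} (hy : Continuous y) :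
    Continuous (forcing β k p M y) := by
  have := (continuous_truncPow (k := k) (M := M) hp).comp hy
  have h2 : Continuous fun t : ℝ => Real.exp (-β * max t 0) := by fun_prop
  exact h2.mul this

theorem forcing_nonneg {β k p M : ℝ} (hk : 0 ≤ k) (y : ℝ → ℝ) (t : ℝ) : 0 ≤ forcing β k p M y t :=
  mul_nonneg (Real.exp_pos _).le (truncPow_nonneg hk _)

/-- The cutoff `max t 0` extends the bound to negative t, so the forcing is bounded on all of ℝ, as
the resolvent lemmas require. -/
theorem exp_neg_mul_max_le_one {β : ℝ} (hβ : 0 ≤ β) (t : ℝ) : Real.exp (-β * max t 0) ≤ 1 := by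
  rw [Real.exp_le_one_iff]
  nlinarith [mul_nonneg hβ (le_max_right t 0)]

theorem abs_forcing_le {β k p M : ℝ} (hβ : 0 ≤ β) (hk : 0 ≤ k) (hp : 0 ≤ p) (hM : 0 ≤ M)
    (y : ℝ → ℝ) (t : ℝ) : |forcing β k p M y t| ≤ k * M ^ p := by
  rw [abs_of_nonneg (forcing_nonneg hk y t), forcing]
  calc _ ≤ 1 * truncPow k p M (y t) := by
        gcongr
        · exact truncPow_nonneg hk _
        · exact exp_neg_mul_max_le_one hβ t
    _ ≤ k * M ^ p := by rw [one_mul]; exact truncPow_le hk hp hM _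

theorem abs_forcing_sub_le {β k p M : ℝ} (hβ : 0 ≤ β) (hk : 0 ≤ k) (hp : 1 < p) (hM : 0 ≤ M)
    (y₁ y₂ : ℝ → ℝ) (t : ℝ) :
    |forcing β k p M y₁ t - forcing β k p M y₂ t| ≤ k * p * M ^ (p - 1) * |y₁ t - y₂ t| := by
  rw [forcing, forcing, ← mul_sub, abs_mul, Real.abs_exp]
  calc _ ≤ 1 * |truncPow k p M (y₁ t) - truncPow k p M (y₂ t)| := by
        gcongr
        exact exp_neg_mul_max_le_one hβ t
    _ ≤ _ := by rw [one_mul]; exact abs_truncPow_sub_le hk hp hM _ _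

/-- The threshold s²/2 is chosen because each of the two integrations leading from the forcing to y
gains at least a factor 1/s; what remains is the contraction constant 1/2. -/
theorem abs_forcing_sub_le_exp {s C β k p M : ℝ} (hβ : 0 ≤ β) (hk : 0 ≤ k) (hp : 1 < p)
    (hM : 0 ≤ M) (hsmall : k * p * M ^ (p - 1) ≤ s ^ 2 / 2) {y₁ y₂ : ℝ → ℝ}
    (hd : ∀ t ≥ 0, |y₁ t - y₂ t| ≤ C * Real.exp (s * t)) {t : ℝ} (ht : 0 ≤ t) :
    |forcing β k p M y₁ t - forcing β k p M y₂ t| ≤ s ^ 2 / 2 * C * Real.exp (s * t) := by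
  calc _ ≤ k * p * M ^ (p - 1) * |y₁ t - y₂ t| := abs_forcing_sub_le hβ hk hp hM _ _ _
    _ ≤ s ^ 2 / 2 * (C * Real.exp (s * t)) := by
        gcongr
        exact hd t ht
    _ = _ := by ring

theorem forcing_eq {β k p M t : ℝ} {y : ℝ → ℝ} (ht : 0 ≤ t) (h0 : 0 ≤ y t) (hM : y t ≤ M) :
    forcing β k p M y t = Real.exp (-β * t) * (k * y t ^ p) := by
  rw [forcing, max_eq_left ht, truncPow_eq h0 hM]

/-- Existence of a positive solution of `y'' - 2 s y' = exp (-β t) k y ^ p` without exponentially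
growing component: the Lyapunov–Perron method. -/
theorem exists_slow_solution {s β k p M : ℝ} (hs : 0 < s) (hβ : 0 ≤ β) (hk : 0 < k) (hp : 1 < p)
    (hM : 0 < M) (hsmall : k * p * M ^ (p - 1) ≤ s ^ 2 / 2) :
    ∃ y q : ℝ → ℝ, Continuous y ∧ AntitoneOn y (Ici 0) ∧ (∀ t ≥ 0, 0 < y t ∧ y t ≤ M) ∧
      (∀ t > 0, HasDerivAt y (-q t) t) ∧
      (∀ t > 0, HasDerivAt q (2 * s * q t - Real.exp (-β * t) * (k * y t ^ p)) t) ∧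
      (∀ t ≥ 0, 0 ≤ q t ∧ q t ≤ Real.exp (-β * t) * (k * y t ^ p) / (2 * s)) ∧
      (β = 0 → ∀ t ≥ 0, k * y t ^ p / (2 * s + p * (k * y t ^ (p - 1) / (2 * s))) ≤ q t) := by
  have hp0 : 0 ≤ p := by linarith
  have h2s : 0 < 2 * s := by linarith
  have hGB : ∀ y t, |forcing β k p M y t| ≤ k * M ^ p := abs_forcing_le hβ hk.le hp0 hM.le
  have hGc : ∀ y, Continuous y → Continuous (forcing β k p M y) := fun y hy =>
    continuous_forcing hp0 hy
  have hRd : ∀ y, Continuous y → ∀ t, HasDerivAt (expResolvent (2 * s) (forcing β k p M y))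
      (2 * s * expResolvent (2 * s) (forcing β k p M y) t - forcing β k p M y t) t :=
    fun y hy t => hasDerivAt_expResolvent h2s (hGc y hy) (hGB y) t
  have hRnn : ∀ y, Continuous y → ∀ t, 0 ≤ expResolvent (2 * s) (forcing β k p M y) t := by
    intro y hy t
    have := le_expResolvent (a := 2 * s) (b := 0) (A := 0) (t := t) h2s h2s (hGc y hy) (hGB y)
      (fun h _ => by rw [zero_mul]; exact forcing_nonneg hk.le _ _)
    simpa using this
  obtain ⟨y, hyc, hy0, hyd⟩ := exists_nonlocal_solution (B := k * M ^ p / (2 * s)) hs M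
    (W := fun y t => -expResolvent (2 * s) (forcing β k p M y) t)
    (fun y hy => (continuous_iff_continuousAt.2 fun t => (hRd y hy t).continuousAt).neg)
    (fun y hy t ht => by
      rw [abs_neg, abs_of_nonneg (hRnn y hy t)]
      have := expResolvent_le (a := 2 * s) (b := 0) (A := k * M ^ p) (t := t) h2s h2s
        (hGc y hy) (hGB y) (fun h _ => by simpa using (le_abs_self _).trans (hGB y (t + h)))
      simpa using this)
    (fun y₁ y₂ C h₁ h₂ hd t ht => by
      -- The weight rate s lies halfway between the characteristic rates 0 and 2s of y'' − 2sy' = 0,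
      -- so the resolvent gains 1/(2s − s).
      have := abs_expResolvent_sub_le (a := 2 * s) (b := s)
        (A := s ^ 2 / 2 * C * Real.exp (s * t)) (t := t) h2s (by linarith)
        (hGc y₁ h₁) (hGc y₂ h₂) (hGB y₁) (hGB y₂) (fun h hh => by
          refine (abs_forcing_sub_le_exp hβ hk.le hp hM.le hsmall hd (by linarith)).trans
            (le_of_eq ?_)
          rw [mul_add, Real.exp_add]; ring)
      rw [neg_sub_neg, abs_sub_comm]
      refine this.trans (le_of_eq ?_)
      field_simp
      ring)
  set q := expResolvent (2 * s) (forcing β k p M y) with hq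
  have hqnn : ∀ t, 0 ≤ q t := hRnn y hyc
  have hanti : AntitoneOn y (Ici 0) := by
    refine antitoneOn_of_deriv_nonpos (convex_Ici 0) hyc.continuousOn ?_ ?_
    · rw [interior_Ici]
      exact fun t ht => (hyd t ht).differentiableAt.differentiableWithinAt
    · rw [interior_Ici]
      intro t ht
      rw [(hyd t ht).deriv]
      exact neg_nonpos.2 (hqnn t)
  have hyM : ∀ t ≥ 0, y t ≤ M := fun t ht => hy0 ▸ hanti self_mem_Ici ht ht
  -- As y and the exponential factor both decrease, the forcing at t dominates all later values.
  have hqle : ∀ t ≥ 0, q t ≤ Real.exp (-β * t) * truncPow k p M (y t) / (2 * s) := by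
    intro t ht
    have := expResolvent_le (a := 2 * s) (b := 0)
      (A := Real.exp (-β * t) * truncPow k p M (y t)) (t := t) h2s h2s
      (hGc y hyc) (hGB y) (fun h hh => by
        have hth : 0 ≤ t + h := by linarith
        rw [zero_mul, Real.exp_zero, mul_one, forcing, max_eq_left hth]
        gcongr ?_ * ?_
        · exact truncPow_nonneg hk.le _
        · rw [Real.exp_le_exp]
          nlinarith
        · exact truncPow_mono hk.le hp0 (hanti ht hth (by linarith)))
    simpa using this
  set c := k * M ^ (p - 1) / (2 * s) with hc
  have hqlin : ∀ t ≥ 0, 0 ≤ y t → q t ≤ c * y t := by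
    intro t ht hyt
    refine (hqle t ht).trans ?_
    have h1 := truncPow_le_linear hk.le hp hM.le hyt
    have h2 : Real.exp (-β * t) ≤ 1 := by
      simpa [max_eq_left ht] using exp_neg_mul_max_le_one hβ t
    rw [hc, div_mul_eq_mul_div]
    refine div_le_div_of_nonneg_right ?_ h2s.le
    calc _ ≤ 1 * truncPow k p M (y t) := by
          gcongr
          exact truncPow_nonneg hk.le _
      _ ≤ _ := by rw [one_mul]; exact h1
  have hypos : ∀ t ≥ 0, 0 < y t := by
    intro t₁ ht₁
    by_contra! hneg
    -- At the first point where y ≤ 0, Gronwall on the preceding interval gives e^(ct) y(t) ≥ y(0) =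
    -- M > 0, a contradiction.
    set S := Icc 0 t₁ ∩ y ⁻¹' Iic 0 with hS
    have hSc : IsCompact S := isCompact_Icc.inter_right (isClosed_Iic.preimage hyc)
    have hSne : S.Nonempty := ⟨t₁, ⟨ht₁, le_rfl⟩, hneg⟩
    obtain ⟨⟨ht0, ht01⟩, hyt0⟩ := hSc.sInf_mem hSne
    have hlt : ∀ x ∈ Ioo 0 (sInf S), 0 < y x := by
      intro x hx
      by_contra! hcon
      exact not_le.2 hx.2 (csInf_le hSc.bddBelow ⟨⟨hx.1.le, hx.2.le.trans ht01⟩, hcon⟩)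
    have := exp_mul_le_exp_mul_of_deriv (c := c) ht0 hyc (fun x hx => hyd x hx.1)
      (fun x hx => hqlin x hx.1.le (hlt x hx).le)
    rw [mul_zero, Real.exp_zero, one_mul, hy0] at this
    have h3 : Real.exp (c * sInf S) * y (sInf S) ≤ 0 :=
      mul_nonpos_of_nonneg_of_nonpos (Real.exp_pos _).le hyt0
    linarith
  have hqle' : ∀ t ≥ 0, q t ≤ Real.exp (-β * t) * (k * y t ^ p) / (2 * s) := fun t ht => by
    have := hqle t ht
    rwa [truncPow_eq (hypos t ht).le (hyM t ht)] at this
  refine ⟨y, q, hyc, hanti, fun t ht => ⟨hypos t ht, hyM t ht⟩, hyd, fun t ht => ?_,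
    fun t ht => ⟨hqnn t, hqle' t ht⟩, fun hβ0 t ht => ?_⟩
  · refine (hRd y hyc t).congr_deriv ?_
    rw [forcing_eq ht.le (hypos t ht.le).le (hyM t ht.le)]
  -- For β = 0, the upper bound gives q ≤ C y on [t, ∞), hence y(t + h) ≥ y(t) e^(-Ch). Feeding this
  -- back into the integral for q yields the matching lower bound, with denominator 2s + pC.
  · set C := k * y t ^ (p - 1) / (2 * s) with hC
    have hC0 : 0 ≤ C := by have := hypos t ht; positivity
    have hlow : ∀ h > 0, y t * Real.exp (-C * h) ≤ y (t + h) := by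
      intro h hh
      have := exp_mul_le_exp_mul_of_deriv (c := C) (a := t) (b := t + h) (by linarith) hyc
        (fun x hx => hyd x (by linarith [hx.1])) (fun x hx => by
          have hx0 : 0 ≤ x := by linarith [hx.1]
          have hyx := hypos x hx0
          refine (hqle' x hx0).trans ?_
          rw [hβ0, neg_zero, zero_mul, Real.exp_zero, one_mul, hC, div_mul_eq_mul_div, mul_assoc]
          gcongr
          calc y x ^ p = y x ^ (p - 1) * y x := by
                rw [← Real.rpow_add_one hyx.ne', sub_add_cancel]
            _ ≤ _ := by
                gcongr
                exact hanti ht hx0 hx.1.le)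
      rw [mul_add, Real.exp_add, mul_assoc] at this
      have h4 := le_of_mul_le_mul_left this (Real.exp_pos _)
      calc y t * Real.exp (-C * h) ≤ (Real.exp (C * h) * y (t + h)) * Real.exp (-C * h) := by gcongr
        _ = (Real.exp (C * h) * Real.exp (-C * h)) * y (t + h) := by ring
        _ = y (t + h) := by rw [← Real.exp_add]; simp
    have := le_expResolvent (a := 2 * s) (b := -(p * C)) (A := k * y t ^ p) (t := t) h2s
      (by nlinarith) (hGc y hyc) (hGB y) (fun h hh => by
        have hth : 0 ≤ t + h := by linarith
        rw [forcing_eq hth (hypos _ hth).le (hyM _ hth), hβ0, neg_zero, zero_mul, Real.exp_zero,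
          one_mul, mul_assoc]
        gcongr
        calc y t ^ p * Real.exp (-(p * C) * h) = (y t * Real.exp (-C * h)) ^ p := by
              rw [Real.mul_rpow (hypos t ht).le (Real.exp_pos _).le, ← Real.exp_mul]
              congr 2
              ring
          _ ≤ _ := by
              have := hypos t ht
              gcongr
              exact hlow h hh)
    rwa [sub_neg_eq_add] at this

/-! ### The fast solution, for the exponent τ⁺ -/

theorem abs_exp_mul_integral_le {a b A t : ℝ} (hab : 0 < a + b) (hA : 0 ≤ A) (ht : 0 ≤ t)
    {G : ℝ → ℝ} (h : ∀ x ∈ Ioc 0 t, |G x| ≤ A * Real.exp (b * x)) :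
    |Real.exp (-a * t) * ∫ x in (0 : ℝ)..t, Real.exp (a * x) * G x|
      ≤ A / (a + b) * Real.exp (b * t) := by
  have hint : ∫ x in (0 : ℝ)..t, A * Real.exp ((a + b) * x)
      = A / (a + b) * Real.exp ((a + b) * t) - A / (a + b) * Real.exp ((a + b) * 0) := by
    refine intervalIntegral.integral_eq_sub_of_hasDerivAt
      (f := fun x => A / (a + b) * Real.exp ((a + b) * x)) (fun x _ => ?_)
      (by apply Continuous.intervalIntegrable; fun_prop)
    exact ((((hasDerivAt_id x).const_mul (a + b)).exp).const_mul (A / (a + b))).congr_deriv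
      (by simp; field_simp)
  have hle := intervalIntegral.norm_integral_le_of_norm_le (f := fun x => Real.exp (a * x) * G x)
    (g := fun x => A * Real.exp ((a + b) * x)) (μ := volume) ht
    (Eventually.of_forall fun x hx => by
      rw [Real.norm_eq_abs, abs_mul, Real.abs_exp]
      calc _ ≤ Real.exp (a * x) * (A * Real.exp (b * x)) := by gcongr; exact h x hx
        _ = _ := by rw [add_mul, Real.exp_add]; ring)
    (by apply Continuous.intervalIntegrable; fun_prop)
  rw [hint, Real.norm_eq_abs] at hle
  rw [abs_mul, Real.abs_exp]
  have h0 : 0 ≤ A / (a + b) * Real.exp ((a + b) * 0) := by positivity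
  calc _ ≤ Real.exp (-a * t) * (A / (a + b) * Real.exp ((a + b) * t)) := by
        gcongr
        linarith
    _ = A / (a + b) * (Real.exp (-a * t) * Real.exp ((a + b) * t)) := by ring
    _ = _ := by rw [← Real.exp_add]; congr 2; ring

/-- Existence of a positive bounded increasing solution of `y'' + 2 s y' = exp (-β t) k y ^ p`. -/
theorem exists_fast_solution {s β k p M : ℝ} (hs : 0 < s) (hβ : 0 < β) (hk : 0 < k) (hp : 1 < p)
    (hM : 0 < M) (hsmall : k * p * M ^ (p - 1) ≤ s ^ 2 / 2) (hsmall' : k * M ^ (p - 1) ≤ s * β) :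
    ∃ y w : ℝ → ℝ, MonotoneOn y (Ici 0) ∧ (∀ t ≥ 0, M / 2 ≤ y t ∧ y t ≤ M) ∧
      (∀ t > 0, HasDerivAt y (w t) t) ∧
      (∀ t > 0, HasDerivAt w (-(2 * s) * w t + Real.exp (-β * t) * (k * y t ^ p)) t) ∧
      (∀ t ≥ 0, 0 ≤ w t) := by
  have hp0 : 0 ≤ p := by linarith
  have hGB : ∀ y t, |forcing β k p M y t| ≤ k * M ^ p := abs_forcing_le hβ.le hk.le hp0 hM.le
  have hGc : ∀ y, Continuous y → Continuous (forcing β k p M y) := fun y hy =>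
    continuous_forcing hp0 hy
  let W : (ℝ → ℝ) → ℝ → ℝ := fun y t => Real.exp (-(2 * s) * t) *
    ∫ x in (0 : ℝ)..t, Real.exp (2 * s * x) * forcing β k p M y x
  have hWd : ∀ y, Continuous y → ∀ t,
      HasDerivAt (W y) (-(2 * s) * W y t + forcing β k p M y t) t := by
    intro y hy t
    have hc : Continuous fun x => Real.exp (2 * s * x) * forcing β k p M y x := by
      have := hGc y hy
      fun_prop
    have := (((hasDerivAt_id t).const_mul (-(2 * s))).exp).mul
      ((hc.integral_hasStrictDerivAt 0 t).hasDerivAt)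
    refine this.congr_deriv ?_
    have he : Real.exp (-(2 * s) * t) * Real.exp (2 * s * t) = 1 := by rw [← Real.exp_add]; simp
    simp only [id, W, mul_one]
    linear_combination (forcing β k p M y t) * he
  have hWc : ∀ y, Continuous y → Continuous (W y) := fun y hy =>
    continuous_iff_continuousAt.2 fun t => (hWd y hy t).continuousAt
  have hWnn : ∀ y, ∀ t ≥ 0, 0 ≤ W y t := fun y t ht =>
    mul_nonneg (Real.exp_pos _).le (intervalIntegral.integral_nonneg ht fun x _ =>
      mul_nonneg (Real.exp_pos _).le (forcing_nonneg hk.le _ _))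
  -- Starting at M/2 leaves room for y to increase without leaving [0, M].
  obtain ⟨y, hyc, hy0, hyd⟩ := exists_nonlocal_solution (B := k * M ^ p / (2 * s)) hs (M / 2)
    (W := W) hWc
    (fun y hy t ht => by
      have := abs_exp_mul_integral_le (a := 2 * s) (b := 0) (A := k * M ^ p) (by linarith)
        (by positivity) ht (G := forcing β k p M y) (fun x _ => by simpa using hGB y x)
      rwa [zero_mul, Real.exp_zero, mul_one, add_zero] at this)
    (fun y₁ y₂ C h₁ h₂ hd t ht => by
      have hC : 0 ≤ C := by
        have := (abs_nonneg _).trans (hd 0 le_rfl)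
        simpa using this
      have hi : ∀ y, Continuous y → IntervalIntegrable
          (fun x => Real.exp (2 * s * x) * forcing β k p M y x) volume 0 t := fun y hy => by
        have := hGc y hy
        apply Continuous.intervalIntegrable
        fun_prop
      have := abs_exp_mul_integral_le (a := 2 * s) (b := s) (A := s ^ 2 / 2 * C) (by linarith)
        (by positivity) ht (G := fun x => forcing β k p M y₁ x - forcing β k p M y₂ x)
        (fun x hx => abs_forcing_sub_le_exp hβ.le hk.le hp hM.le hsmall hd hx.1.le)
      simp only [W]
      rw [← mul_sub, ← intervalIntegral.integral_sub (hi _ h₁) (hi _ h₂)]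
      simp only [← mul_sub]
      refine this.trans (mul_le_mul_of_nonneg_right ?_ (Real.exp_pos _).le)
      rw [div_le_iff₀ (by linarith)]
      nlinarith [mul_nonneg (sq_nonneg s) hC])
  have hmono : MonotoneOn y (Ici 0) := by
    refine monotoneOn_of_deriv_nonneg (convex_Ici 0) hyc.continuousOn ?_ ?_
    · rw [interior_Ici]
      exact fun t ht => (hyd t ht).differentiableAt.differentiableWithinAt
    · rw [interior_Ici]
      intro t ht
      rw [(hyd t ht).deriv]
      exact hWnn y t (le_of_lt ht)
  have hylow : ∀ t ≥ 0, M / 2 ≤ y t := fun t ht => hy0 ▸ hmono self_mem_Ici ht ht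
  have hyM : ∀ t ≥ 0, y t ≤ M := by
    -- Since (y' + 2sy)' is the forcing, which is at most k M^p e^(-βt), adding a primitive of that
    -- bound with opposite sign gives a nonincreasing quantity. Its initial value sM + k M^p/β is at
    -- most 2sM.
    have hD : ∀ t > 0, HasDerivAt
        (fun t => W y t + 2 * s * y t + k * M ^ p / β * Real.exp (-β * t))
        (forcing β k p M y t - k * M ^ p * Real.exp (-β * t)) t := fun t ht =>
      (((hWd y hyc t).add ((hyd t ht).const_mul (2 * s))).add
        ((((hasDerivAt_id t).const_mul (-β)).exp).const_mul (k * M ^ p / β))).congr_deriv (by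
          simp only [id, mul_one]
          field_simp
          ring)
    have hant : AntitoneOn (fun t => W y t + 2 * s * y t + k * M ^ p / β * Real.exp (-β * t))
        (Ici 0) := by
      refine antitoneOn_of_deriv_nonpos (convex_Ici 0) ?_ ?_ ?_
      · have := hWc y hyc
        apply Continuous.continuousOn
        fun_prop
      · rw [interior_Ici]
        exact fun t ht => (hD t ht).differentiableAt.differentiableWithinAt
      · rw [interior_Ici]
        intro t ht
        rw [(hD t ht).deriv, forcing, max_eq_left (le_of_lt ht), sub_nonpos, mul_comm]
        gcongr
        exact truncPow_le hk.le hp0 hM.le _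
    intro t ht
    have h1 := hant self_mem_Ici ht ht
    have hW0 : W y 0 = 0 := by simp [W]
    simp only [hW0, hy0, mul_zero, Real.exp_zero, mul_one, zero_add] at h1
    have h2 := hWnn y t ht
    have h3 : 0 ≤ k * M ^ p / β * Real.exp (-β * t) := by positivity
    have h4 : k * M ^ p / β ≤ s * M := by
      rw [div_le_iff₀ hβ]
      calc k * M ^ p = k * M ^ (p - 1) * M := by
            rw [mul_assoc, ← Real.rpow_add_one hM.ne', sub_add_cancel]
        _ ≤ s * β * M := by gcongr
        _ = _ := by ring
    have h5 : 2 * s * y t ≤ 2 * s * M := by linarith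
    exact le_of_mul_le_mul_left h5 (by linarith)
  refine ⟨y, W y, hmono, fun t ht => ⟨hylow t ht, hyM t ht⟩, hyd, fun t ht => ?_, hWnn y⟩
  refine (hWd y hyc t).congr_deriv ?_
  rw [forcing_eq ht.le (by linarith [hylow t ht.le]) (hyM t ht.le)]

/-! ### Limits and decay rates -/

theorem exists_tendsto_of_monotoneOn {y : ℝ → ℝ} {m : ℝ} (hy : MonotoneOn y (Ici 0))
    (hm : ∀ t ≥ 0, y t ≤ m) : ∃ c, Tendsto y atTop (𝓝 c) ∧ ∀ t ≥ 0, y t ≤ c := by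
  have hmono : Monotone fun t => y (max t 0) := fun a b h =>
    hy (mem_Ici.2 (le_max_right a 0)) (mem_Ici.2 (le_max_right b 0)) (max_le_max_right 0 h)
  have hbdd : BddAbove (range fun t => y (max t 0)) :=
    ⟨m, by rintro _ ⟨t, rfl⟩; exact hm _ (le_max_right _ _)⟩
  refine ⟨_, (tendsto_atTop_ciSup hmono hbdd).congr' ?_, fun t ht => ?_⟩
  · filter_upwards [eventually_ge_atTop 0] with t ht
    rw [max_eq_left ht]
  · simpa [max_eq_left ht] using le_ciSup hbdd t

theorem exists_tendsto_of_antitoneOn {y : ℝ → ℝ} {m : ℝ} (hy : AntitoneOn y (Ici 0))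
    (hm : ∀ t ≥ 0, m ≤ y t) : ∃ c, Tendsto y atTop (𝓝 c) ∧ m ≤ c ∧ ∀ t ≥ 0, c ≤ y t := by
  obtain ⟨c, hc, hle⟩ := exists_tendsto_of_monotoneOn (y := fun t => -y t) (m := -m) hy.neg
    (fun t ht => neg_le_neg (hm t ht))
  have hc' : Tendsto y atTop (𝓝 (-c)) := by simpa using hc.neg
  refine ⟨-c, hc', ge_of_tendsto hc' ?_, fun t ht => by linarith [hle t ht]⟩
  filter_upwards [eventually_ge_atTop 0] with t ht using hm t ht

/-- A positive function with `y' ≥ -c exp (-β t) y` has a positive lower bound. -/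
theorem exists_pos_lower_bound {y q : ℝ → ℝ} {β c : ℝ} (hβ : 0 < β) (hc : 0 ≤ c)
    (hy : Continuous y) (hpos : ∀ t ≥ 0, 0 < y t) (hd : ∀ t > 0, HasDerivAt y (-q t) t)
    (hq : ∀ t > 0, q t ≤ c * Real.exp (-β * t) * y t) : ∃ m > 0, ∀ t ≥ 0, m ≤ y t := by
  -- The exponent is a bounded primitive of c e^(-βt); with this integrating factor the product is
  -- nondecreasing.
  have hD : ∀ t > 0, HasDerivAt (fun t => Real.exp (-(c / β) * Real.exp (-β * t)) * y t)
      (Real.exp (-(c / β) * Real.exp (-β * t)) * (c * Real.exp (-β * t) * y t - q t)) t :=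
    fun t ht => ((((((hasDerivAt_id t).const_mul (-β)).exp).const_mul (-(c / β))).exp).mul
      (hd t ht)).congr_deriv (by
        simp only [id, mul_one]
        field_simp
        ring)
  have hmono : MonotoneOn (fun t => Real.exp (-(c / β) * Real.exp (-β * t)) * y t) (Ici 0) := by
    refine monotoneOn_of_deriv_nonneg (convex_Ici 0) (by fun_prop) ?_ ?_
    · rw [interior_Ici]
      exact fun t ht => (hD t ht).differentiableAt.differentiableWithinAt
    · rw [interior_Ici]
      intro t ht
      rw [(hD t ht).deriv]
      exact mul_nonneg (Real.exp_pos _).le (by linarith [hq t ht])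
  refine ⟨Real.exp (-(c / β) * Real.exp (-β * 0)) * y 0,
    mul_pos (Real.exp_pos _) (hpos 0 le_rfl), fun t ht => (hmono self_mem_Ici ht ht).trans ?_⟩
  have : Real.exp (-(c / β) * Real.exp (-β * t)) ≤ 1 := by
    rw [Real.exp_le_one_iff]
    have : 0 ≤ c / β * Real.exp (-β * t) := by positivity
    linarith
  exact mul_le_of_le_one_left (hpos t ht).le this

/-- L'Hôpital at infinity: the mean value inequality bounds z(t) − κt by (ε/2)t plus a constant for
large t. -/
theorem tendsto_div_of_tendsto_deriv {z z' : ℝ → ℝ} {κ : ℝ} (hd : ∀ t > 0, HasDerivAt z (z' t) t)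
    (hlim : Tendsto z' atTop (𝓝 κ)) : Tendsto (fun t => z t / t) atTop (𝓝 κ) := by
  rw [Metric.tendsto_atTop] at hlim ⊢
  intro ε hε
  obtain ⟨T₀, hT₀⟩ := hlim (ε / 2) (by positivity)
  set T := max T₀ 1
  have hT1 : 1 ≤ T := le_max_right _ _
  have hmv : ∀ t ≥ T, |(z t - κ * t) - (z T - κ * T)| ≤ ε / 2 * (t - T) := by
    intro t ht
    have := (convex_Ici T).norm_image_sub_le_of_norm_hasDerivWithin_le
      (f := fun t => z t - κ * t) (f' := fun t => z' t - κ) (C := ε / 2)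
      (fun x hx => (((hd x (by linarith [mem_Ici.1 hx])).sub
        ((hasDerivAt_id x).const_mul κ)).congr_deriv (by simp)).hasDerivWithinAt)
      (fun x hx => (hT₀ x ((le_max_left _ _).trans hx)).le) self_mem_Ici (mem_Ici.2 ht)
    rwa [Real.norm_eq_abs, Real.norm_eq_abs, abs_of_nonneg (sub_nonneg.2 ht)] at this
  set D := |z T - κ * T|
  have hD : 0 ≤ D := abs_nonneg _
  refine ⟨max T (2 * D / ε + 1), fun t ht => ?_⟩
  have htT : T ≤ t := (le_max_left _ _).trans ht
  have ht2 : 2 * D / ε + 1 ≤ t := (le_max_right _ _).trans ht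
  have ht0 : 0 < t := by linarith
  have h1 : |z t - κ * t| ≤ ε / 2 * (t - T) + D := by
    have h2 := hmv t htT
    calc |z t - κ * t| = |((z t - κ * t) - (z T - κ * T)) + (z T - κ * T)| := by ring_nf
      _ ≤ _ := (abs_add_le _ _).trans (add_le_add h2 le_rfl)
  have h3 : 2 * D < ε * t := by
    have : 2 * D / ε < t := by linarith
    rwa [div_lt_iff₀ hε, mul_comm t] at this
  have h4 : z t / t - κ = (z t - κ * t) / t := by field_simp
  rw [Real.dist_eq, h4, abs_div, abs_of_pos ht0, div_lt_iff₀ ht0]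
  nlinarith

/-- Asymptotics of the slow solution in the autonomous case. -/
theorem tendsto_rpow_mul_of_autonomous {s k p M : ℝ} (hs : 0 < s) (hk : 0 < k) (hp : 1 < p)
    {y q : ℝ → ℝ} (hyc : Continuous y) (hanti : AntitoneOn y (Ici 0))
    (hy : ∀ t ≥ 0, 0 < y t ∧ y t ≤ M) (hd : ∀ t > 0, HasDerivAt y (-q t) t)
    (hup : ∀ t ≥ 0, q t ≤ k * y t ^ p / (2 * s))
    (hlow : ∀ t ≥ 0, k * y t ^ p / (2 * s + p * (k * y t ^ (p - 1) / (2 * s))) ≤ q t) :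
    Tendsto (fun t => t ^ (1 / (p - 1)) * y t) atTop
      (𝓝 (((p - 1) * k / (2 * s)) ^ (-(1 / (p - 1))))) := by
  have hp1 : 0 < p - 1 := by linarith
  obtain ⟨l, hl, hl0, hle⟩ := exists_tendsto_of_antitoneOn hanti fun t ht => (hy t ht).1.le
  -- A positive limit would keep −y' above some d > 0, so y would be nonpositive by time y(0)/d.
  have hl_zero : l = 0 := by
    by_contra hne
    have hlpos : 0 < l := lt_of_le_of_ne hl0 (Ne.symm hne)
    have hMpos : 0 < M := (hy 0 le_rfl).1.trans_le (hy 0 le_rfl).2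
    set d := k * l ^ p / (2 * s + p * (k * M ^ (p - 1) / (2 * s))) with hdd
    have hdpos : 0 < d := by positivity
    have hqd : ∀ t ≥ 0, d ≤ q t := fun t ht => by
      refine le_trans ?_ (hlow t ht)
      have h1 := hy t ht
      have h2 := hle t ht
      have h3 := h1.1
      have h4 := h1.2
      rw [hdd]
      gcongr
    have hD : ∀ t > 0, HasDerivAt (fun t => y t + d * t) (-q t + d) t := fun t ht =>
      ((hd t ht).add ((hasDerivAt_id t).const_mul d)).congr_deriv (by simp)
    have hant : AntitoneOn (fun t => y t + d * t) (Ici 0) := by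
      refine antitoneOn_of_deriv_nonpos (convex_Ici 0) (by fun_prop) ?_ ?_
      · rw [interior_Ici]
        exact fun t ht => (hD t ht).differentiableAt.differentiableWithinAt
      · rw [interior_Ici]
        intro t ht
        rw [(hD t ht).deriv]
        linarith [hqd t (le_of_lt ht)]
    have hT : 0 ≤ y 0 / d := div_nonneg (hy 0 le_rfl).1.le hdpos.le
    have h5 := hant self_mem_Ici hT hT
    simp only [mul_zero, add_zero] at h5
    rw [mul_div_cancel₀ _ hdpos.ne'] at h5
    linarith [(hy _ hT).1]
  rw [hl_zero] at hl
  -- The power 1 − p linearizes y' ~ -k y^p/(2s): the derivative of y^(1−p) converges, since the two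
  -- bounds on q/y^p merge as y → 0.
  have hzd : ∀ t > 0, HasDerivAt (fun t => y t ^ (1 - p)) ((p - 1) * (q t / y t ^ p)) t := by
    intro t ht
    have hyt := (hy t ht.le).1
    refine ((hd t ht).rpow_const (Or.inl hyt.ne')).congr_deriv ?_
    rw [show 1 - p - 1 = -p by ring, Real.rpow_neg hyt.le]
    field_simp
    ring
  have hzlim : Tendsto (fun t => (p - 1) * (q t / y t ^ p)) atTop (𝓝 ((p - 1) * k / (2 * s))) := by
    rw [mul_div_assoc]
    refine Tendsto.const_mul _ ?_
    have hlo : Tendsto (fun t => k / (2 * s + p * (k * y t ^ (p - 1) / (2 * s)))) atTop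
        (𝓝 (k / (2 * s))) := by
      have h1 : Tendsto (fun t => y t ^ (p - 1)) atTop (𝓝 0) := by
        have := hl.rpow_const (p := p - 1) (Or.inr hp1.le)
        rwa [Real.zero_rpow hp1.ne'] at this
      have h2 : Tendsto (fun t => 2 * s + p * (k * y t ^ (p - 1) / (2 * s))) atTop
          (𝓝 (2 * s + p * (k * 0 / (2 * s)))) :=
        (((h1.const_mul k).div_const _).const_mul p).const_add _
      rw [mul_zero, zero_div, mul_zero, add_zero] at h2
      exact tendsto_const_nhds.div h2 (by positivity)
    refine tendsto_of_tendsto_of_tendsto_of_le_of_le' hlo tendsto_const_nhds ?_ ?_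
    · filter_upwards [eventually_ge_atTop 0] with t ht
      have hyt := (hy t ht).1
      rw [le_div_iff₀ (by positivity)]
      refine le_trans (le_of_eq ?_) (hlow t ht)
      ring
    · filter_upwards [eventually_ge_atTop 0] with t ht
      have hyt := (hy t ht).1
      rw [div_le_iff₀ (by positivity)]
      refine (hup t ht).trans (le_of_eq ?_)
      ring
  have hdiv := (tendsto_div_of_tendsto_deriv hzd hzlim).rpow_const (p := -(1 / (p - 1)))
    (Or.inl (by positivity))
  refine hdiv.congr' ?_
  filter_upwards [eventually_gt_atTop 0] with t ht
  have hyt := (hy t ht.le).1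
  rw [Real.div_rpow (Real.rpow_nonneg hyt.le _) ht.le, ← Real.rpow_mul hyt.le,
    Real.rpow_neg ht.le, div_inv_eq_mul, mul_comm]
  congr 1
  rw [show (1 - p) * -(1 / (p - 1)) = 1 by field_simp; ring, Real.rpow_one]

/-! ### Back to the radial variable; the roots τ⁺ and τ⁻ -/

theorem exists_rpow_eq {e δ : ℝ} (he : e ≠ 0) (hδ : 0 < δ) : ∃ M > 0, M ^ e = δ :=
  ⟨δ ^ (1 / e), Real.rpow_pos_of_pos hδ _, by
    rw [← Real.rpow_mul hδ.le, one_div_mul_cancel he, Real.rpow_one]⟩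

theorem tendsto_comp_neg_log {g : ℝ → ℝ} {c : ℝ} (hg : Tendsto g atTop (𝓝 c)) :
    Tendsto (fun r => g (-Real.log r)) (𝓝[>] 0) (𝓝 c) :=
  hg.comp (tendsto_neg_atBot_atTop.comp Real.tendsto_log_nhdsGT_zero)

theorem tendsto_rpow_mul_emden {σ c : ℝ} {y : ℝ → ℝ} (hy : Tendsto y atTop (𝓝 c)) :
    Tendsto (fun r : ℝ => r ^ σ * (r ^ (-σ) * y (-Real.log r))) (𝓝[>] 0) (𝓝 c) := by
  refine (tendsto_comp_neg_log hy).congr' ?_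
  filter_upwards [self_mem_nhdsWithin] with r hr
  have hr : 0 < r := hr
  rw [← mul_assoc, ← Real.rpow_add hr, add_neg_cancel, Real.rpow_zero, one_mul]

theorem tau_sq_sub_pos {N : ℕ} {lam Lam μ : ℝ} (hLam : 0 < Lam) (hμ' : μ < lamBar N lam Lam) :
    0 < tau N lam Lam ^ 2 - μ / Lam := by
  rw [sub_pos, div_lt_iff₀ hLam, mul_comm]
  exact hμ'

/-- With the product formula, this is Vieta for X² − 2τX + μ/Λ, the zero-order coefficient of the
Emden–Fowler equation at σ = X. -/
theorem tauPlus_add_tauMinus (N : ℕ) (lam Lam μ : ℝ) :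
    tauPlus N lam Lam μ + tauMinus N lam Lam μ = 2 * tau N lam Lam := by
  unfold tauPlus tauMinus
  ring

theorem tauPlus_mul_tauMinus {N : ℕ} {lam Lam μ : ℝ} (hLam : 0 < Lam)
    (hμ' : μ < lamBar N lam Lam) :
    tauPlus N lam Lam μ * tauMinus N lam Lam μ = μ / Lam := by
  have h := Real.sq_sqrt (tau_sq_sub_pos hLam hμ').le
  unfold tauPlus tauMinus
  linear_combination -h

theorem tauMinus_lt_tauPlus {N : ℕ} {lam Lam μ : ℝ} (hLam : 0 < Lam)
    (hμ' : μ < lamBar N lam Lam) : tauMinus N lam Lam μ < tauPlus N lam Lam μ := by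
  have h := Real.sqrt_pos.2 (tau_sq_sub_pos hLam hμ')
  unfold tauPlus tauMinus
  linarith

/-! ### The three families of solutions -/

/-- The explicit solution `K r ^ (-2 / (p - 1))`. -/
theorem isSolution_explicit {N : ℕ} {lam Lam μ p : ℝ} (hLam : 0 < Lam)
    (hμ' : μ < lamBar N lam Lam) (hp : 1 < p)
    (hK : 0 < (2 / (p - 1) - tauPlus N lam Lam μ) * (2 / (p - 1) - tauMinus N lam Lam μ)) :
    IsSolution N lam Lam μ p (fun r => r ^ (-(2 / (p - 1))) * constK N lam Lam μ p) := by
  have hp1 : 0 < p - 1 := by linarith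
  have hA : 0 < Lam * (2 / (p - 1) - tauPlus N lam Lam μ) * (2 / (p - 1) - tauMinus N lam Lam μ) := by
    rw [mul_assoc]; exact mul_pos hLam hK
  have hKpos : 0 < constK N lam Lam μ p := Real.rpow_pos_of_pos hA _
  have hKp : constK N lam Lam μ p ^ p
      = Lam * (2 / (p - 1) - tauPlus N lam Lam μ) * (2 / (p - 1) - tauMinus N lam Lam μ)
        * constK N lam Lam μ p := by
    have : constK N lam Lam μ p ^ p = constK N lam Lam μ p ^ (p - 1) * constK N lam Lam μ p := by
      rw [← Real.rpow_add_one hKpos.ne', sub_add_cancel]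
    rw [this, constK, ← Real.rpow_mul hA.le, one_div_mul_cancel hp1.ne', Real.rpow_one]
  set α := 2 / (p - 1) with hα
  have hα0 : 0 < α := by positivity
  refine isSolution_of_emden (σ := α) hLam.ne' (y := fun _ => constK N lam Lam μ p)
    (y₁ := fun _ => 0) (y₂ := fun _ => 0) contDiffOn_const (fun _ _ => hKpos)
    (fun t _ => hasDerivAt_const t _) (fun t _ => hasDerivAt_const t _) (fun t _ => ?_)
    (fun t _ => ?_) (fun t _ => ?_)
  · rw [add_zero]; positivity
  · simp only [mul_zero, add_zero]; positivity
  · have hb : 2 - α * (p - 1) = 0 := by rw [hα]; field_simp; ring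
    rw [hb, neg_zero, zero_mul, Real.exp_zero, one_mul, hKp, ← tauPlus_mul_tauMinus hLam hμ',
      ← tauPlus_add_tauMinus N lam Lam μ]
    ring

/-- Solutions which behave like `r ^ (-τ⁻)`, with a logarithmic correction in the critical case. -/
theorem exists_isSolution_tauMinus {N : ℕ} {lam Lam μ p : ℝ} (hLam : 0 < Lam)
    (hμ' : μ < lamBar N lam Lam) (hp : 1 < p) (hσ : 0 < tauMinus N lam Lam μ)
    (hβ : 0 ≤ 2 - tauMinus N lam Lam μ * (p - 1)) :
    ∃ y : ℝ → ℝ,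
      IsSolution N lam Lam μ p (fun r => r ^ (-tauMinus N lam Lam μ) * y (-Real.log r)) ∧
      (0 < 2 - tauMinus N lam Lam μ * (p - 1) → ∃ c > 0, Tendsto y atTop (𝓝 c)) ∧
      (2 - tauMinus N lam Lam μ * (p - 1) = 0 →
        Tendsto (fun t => t ^ (1 / (p - 1)) * y t) atTop
          (𝓝 (((p - 1) * (1 / Lam) / (2 * (tau N lam Lam - tauMinus N lam Lam μ)))
            ^ (-(1 / (p - 1)))))) := by
  have hp1 : 0 < p - 1 := by linarith
  have hsum := tauPlus_add_tauMinus N lam Lam μ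
  have hprod := tauPlus_mul_tauMinus hLam hμ'
  have hlt := tauMinus_lt_tauPlus hLam hμ'
  set σ := tauMinus N lam Lam μ
  set s := tau N lam Lam - σ with hs_def
  set β := 2 - σ * (p - 1) with hβ_def
  have hs : 0 < s := by linarith
  set k := 1 / Lam with hk_def
  have hk : 0 < k := by positivity
  -- If q ≤ c₀ y, the negative terms in u'' use up at most half of σ(σ + 1)y, so u'' > 0. Also c₀ <
  -- σ, whence u' < 0. M is then chosen to force this bound together with the contraction.
  set c₀ := σ * (σ + 1) / (2 * (2 * σ + 1 + 2 * s)) with hc₀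
  have hc₀pos : 0 < c₀ := by positivity
  obtain ⟨M, hM, hMδ⟩ := exists_rpow_eq hp1.ne'
    (show 0 < min (s ^ 2 / (2 * (k * p))) (2 * s * c₀ / k) by positivity)
  have hsm1 : k * p * M ^ (p - 1) ≤ s ^ 2 / 2 := by
    have h := hMδ.le.trans (min_le_left _ _)
    rw [le_div_iff₀ (by positivity)] at h
    linarith
  have hsm2 : k * M ^ (p - 1) ≤ 2 * s * c₀ := by
    have h := hMδ.le.trans (min_le_right _ _)
    rwa [le_div_iff₀ hk, mul_comm] at h
  obtain ⟨y, q, hyc, hanti, hy, hyd, hqd, hq, hqlow⟩ :=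
    exists_slow_solution hs hβ hk hp hM hsm1
  have hkey : ∀ t ≥ 0, k * y t ^ p / (2 * s) ≤ c₀ * y t := fun t ht => by
    have hyt := hy t ht
    have hyt0 := hyt.1
    rw [div_le_iff₀ (by positivity)]
    calc k * y t ^ p = k * y t ^ (p - 1) * y t := by
          rw [mul_assoc, ← Real.rpow_add_one hyt.1.ne', sub_add_cancel]
      _ ≤ k * M ^ (p - 1) * y t := by
          gcongr
          exact hyt.2
      _ ≤ 2 * s * c₀ * y t := by gcongr
      _ = _ := by ring
  have hqexp : ∀ t ≥ 0, q t ≤ c₀ * Real.exp (-β * t) * y t := fun t ht => by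
    refine (hq t ht).2.trans ?_
    rw [mul_div_assoc]
    calc _ ≤ Real.exp (-β * t) * (c₀ * y t) := by gcongr; exact hkey t ht
      _ = _ := by ring
  have hqle : ∀ t ≥ 0, q t ≤ c₀ * y t := fun t ht => by
    refine (hqexp t ht).trans ?_
    have h1 := (hy t ht).1
    have h2 : Real.exp (-β * t) ≤ 1 := by
      rw [Real.exp_le_one_iff]
      nlinarith [mul_nonneg hβ ht]
    calc _ ≤ c₀ * 1 * y t := by gcongr
      _ = _ := by ring
  have hc₀2 : c₀ * (2 * (2 * σ + 1 + 2 * s)) = σ * (σ + 1) := by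
    rw [hc₀]; field_simp
  have hc₀σ : c₀ < σ := by
    rw [hc₀, div_lt_iff₀ (by positivity)]
    nlinarith [mul_pos hσ hσ, mul_pos hσ hs]
  refine ⟨y, ?_, fun hβ' => ?_, fun hβ' => ?_⟩
  · refine isSolution_of_emden hLam.ne' (y₁ := fun t => -q t)
      (y₂ := fun t => -(2 * s * q t - Real.exp (-β * t) * (k * y t ^ p))) ?_
      (fun t ht => (hy t ht.le).1) hyd (fun t ht => (hqd t ht).neg) (fun t ht => ?_)
      (fun t ht => ?_) (fun t ht => ?_)
    · refine contDiffOn_of_emden_system (a := 2 * s) (β := β) (k := k) (p := p)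
        (fun t ht => (hy t ht.le).1) hyd fun t ht => ((hqd t ht).neg).congr_deriv (by ring)
    · have h1 := hqle t ht.le
      have h2 := (hy t ht.le).1
      nlinarith
    · have h1 := hqle t ht.le
      have h2 := (hy t ht.le).1
      have h3 : 0 < Real.exp (-β * t) * (k * y t ^ p) := by positivity
      have h4 : (2 * σ + 1 + 2 * s) * q t ≤ (2 * σ + 1 + 2 * s) * (c₀ * y t) := by gcongr
      have h5 : (2 * σ + 1 + 2 * s) * (c₀ * y t) = σ * (σ + 1) * y t / 2 := by
        rw [← hc₀2]; ring
      have h6 : 0 < σ * (σ + 1) * y t := by positivity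
      linarith
    · have h0 : σ ^ 2 - 2 * tau N lam Lam * σ + μ / Lam = 0 := by
        rw [← hsum, ← hprod]; ring
      rw [h0, ← hβ_def, hs_def, hk_def]
      field_simp
      ring
  · obtain ⟨m, hm, hmy⟩ := exists_pos_lower_bound hβ' hc₀pos.le hyc (fun t ht => (hy t ht).1) hyd
      (fun t ht => hqexp t ht.le)
    obtain ⟨c, hc, hmc, -⟩ := exists_tendsto_of_antitoneOn hanti hmy
    exact ⟨c, hm.trans_le hmc, hc⟩
  · refine tendsto_rpow_mul_of_autonomous hs hk hp hyc hanti hy hyd (fun t ht => ?_) (hqlow hβ')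
    simpa [hβ'] using (hq t ht).2

/-- Solutions which behave like `r ^ (-τ⁺)`. -/
theorem exists_isSolution_tauPlus {N : ℕ} {lam Lam μ p : ℝ} (hLam : 0 < Lam)
    (hμ' : μ < lamBar N lam Lam) (hp : 1 < p) (hσ : 0 < tauMinus N lam Lam μ)
    (hβ : 0 < 2 - tauPlus N lam Lam μ * (p - 1)) :
    ∃ y : ℝ → ℝ,
      IsSolution N lam Lam μ p (fun r => r ^ (-tauPlus N lam Lam μ) * y (-Real.log r)) ∧
      ∃ c > 0, Tendsto y atTop (𝓝 c) := by
  have hp1 : 0 < p - 1 := by linarith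
  have hsum := tauPlus_add_tauMinus N lam Lam μ
  have hprod := tauPlus_mul_tauMinus hLam hμ'
  have hlt := tauMinus_lt_tauPlus hLam hμ'
  set σ := tauPlus N lam Lam μ
  set s := σ - tau N lam Lam with hs_def
  set β := 2 - σ * (p - 1) with hβ_def
  have hs : 0 < s := by linarith
  -- Here σ − s = τ > 0; this makes the coefficient 2σ + 1 − 2s of y' in u'' positive.
  have hsσ : s < σ := by linarith
  set k := 1 / Lam with hk_def
  have hk : 0 < k := by positivity
  obtain ⟨M, hM, hMδ⟩ := exists_rpow_eq hp1.ne'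
    (show 0 < min (s ^ 2 / (2 * (k * p))) (s * β / k) by positivity)
  have hsm1 : k * p * M ^ (p - 1) ≤ s ^ 2 / 2 := by
    have h := hMδ.le.trans (min_le_left _ _)
    rw [le_div_iff₀ (by positivity)] at h
    linarith
  have hsm2 : k * M ^ (p - 1) ≤ s * β := by
    have h := hMδ.le.trans (min_le_right _ _)
    rwa [le_div_iff₀ hk, mul_comm] at h
  obtain ⟨y, w, hmono, hy, hyd, hwd, hw⟩ := exists_fast_solution hs hβ hk hp hM hsm1 hsm2
  have hypos : ∀ t ≥ 0, 0 < y t := fun t ht => (half_pos hM).trans_le (hy t ht).1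
  have hσ0 : 0 < σ := hs.trans hsσ
  refine ⟨y, ?_, ?_⟩
  · refine isSolution_of_emden hLam.ne' (y₁ := w)
      (y₂ := fun t => -(2 * s) * w t + Real.exp (-β * t) * (k * y t ^ p))
      (contDiffOn_of_emden_system (fun t ht => hypos t ht.le) hyd hwd)
      (fun t ht => hypos t ht.le) hyd hwd (fun t ht => ?_) (fun t ht => ?_) (fun t ht => ?_)
    · have h1 := hypos t ht.le
      have h2 := hw t ht.le
      positivity
    · have h1 := hypos t ht.le
      have h2 := hw t ht.le
      have h3 : 0 < Real.exp (-β * t) * (k * y t ^ p) := by positivity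
      have h4 : 0 < σ * (σ + 1) * y t := by positivity
      have h5 : 0 ≤ (σ - s) * w t := mul_nonneg (by linarith) h2
      nlinarith
    · have h0 : σ ^ 2 - 2 * tau N lam Lam * σ + μ / Lam = 0 := by
        rw [← hsum, ← hprod]; ring
      rw [h0, ← hβ_def, hs_def, hk_def]
      field_simp
      ring
  · obtain ⟨c, hc, hle⟩ := exists_tendsto_of_monotoneOn hmono fun t ht => (hy t ht).2
    exact ⟨c, (hypos 0 le_rfl).trans_le (hle 0 le_rfl), hc⟩

/-! ### The four ranges of p -/

/-- Superlinear exponents below `1 + 2 / σ` force `σ > 0`. -/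
theorem pos_and_le_of_le_one_add_two_div {p σ : ℝ} (hp : 1 < p) (h : p ≤ 1 + 2 / σ) :
    0 < σ ∧ 0 ≤ 2 - σ * (p - 1) := by
  have h1 : 0 < 2 / σ := by linarith
  have hσ : 0 < σ := (div_pos_iff_of_pos_left two_pos).1 h1
  have h2 : p - 1 ≤ 2 / σ := by linarith
  rw [le_div_iff₀ hσ] at h2
  exact ⟨hσ, by linarith⟩

theorem pos_of_lt_one_add_two_div {p σ : ℝ} (hp : 1 < p) (h : p < 1 + 2 / σ) :
    0 < 2 - σ * (p - 1) := by
  have hσ := (pos_and_le_of_le_one_add_two_div hp h.le).1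
  have h2 : p - 1 < 2 / σ := by linarith
  rw [lt_div_iff₀ hσ] at h2
  linarith

theorem tendsto_explicit {α K : ℝ} :
    Tendsto (fun r : ℝ => r ^ α * (r ^ (-α) * K)) (𝓝[>] 0) (𝓝 K) :=
  tendsto_rpow_mul_emden (y := fun _ => K) tendsto_const_nhds

theorem theorem1p1 (N : ℕ) (hN : 1 ≤ N) (lam Lam μ p : ℝ) (hlam : 0 < lam) (hLam : lam ≤ Lam)
    (hμ : 0 < μ) (hμ' : μ < lamBar N lam Lam) (hp : 1 < p) :
    (p < pStar N lam Lam μ →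
      (∃ u : ℝ → ℝ, IsSolution N lam Lam μ p u ∧
        Tendsto (fun r : ℝ => r ^ (2 / (p - 1)) * u r) (𝓝[>] 0) (𝓝 (constK N lam Lam μ p))) ∧
      (∃ (v : ℝ → ℝ) (c₁ : ℝ), IsSolution N lam Lam μ p v ∧ 0 < c₁ ∧
        Tendsto (fun r : ℝ => r ^ tauPlus N lam Lam μ * v r) (𝓝[>] 0) (𝓝 c₁)) ∧
      (∃ (w : ℝ → ℝ) (c₂ : ℝ), IsSolution N lam Lam μ p w ∧ 0 < c₂ ∧
        Tendsto (fun r : ℝ => r ^ tauMinus N lam Lam μ * w r) (𝓝[>] 0) (𝓝 c₂))) ∧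
    (pStar N lam Lam μ ≤ p → p < pStarStar N lam Lam μ →
      ∃ (u : ℝ → ℝ) (c : ℝ), IsSolution N lam Lam μ p u ∧ 0 < c ∧
        Tendsto (fun r : ℝ => r ^ tauMinus N lam Lam μ * u r) (𝓝[>] 0) (𝓝 c)) ∧
    (p = pStarStar N lam Lam μ →
      ∃ u : ℝ → ℝ, IsSolution N lam Lam μ p u ∧
        Tendsto (fun r : ℝ => r ^ tauMinus N lam Lam μ *
            (-Real.log r) ^ (tauMinus N lam Lam μ / 2) * u r)
          (𝓝[>] 0) (𝓝 (constKBar N lam Lam μ))) ∧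
    (pStarStar N lam Lam μ < p →
      ∃ u : ℝ → ℝ, IsSolution N lam Lam μ p u ∧
        (∀ r ∈ Ioo (0 : ℝ) 1, u r = constK N lam Lam μ p * r ^ (-(2 / (p - 1)))) ∧
        Tendsto (fun r : ℝ => r ^ (2 / (p - 1)) * u r) (𝓝[>] 0)
          (𝓝 (constK N lam Lam μ p))) := by
  have hL : 0 < Lam := hlam.trans_le hLam
  have hp1 : 0 < p - 1 := by linarith
  have hsum := tauPlus_add_tauMinus N lam Lam μ
  have hprod := tauPlus_mul_tauMinus hL hμ'
  have hlt := tauMinus_lt_tauPlus hL hμ'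
  have hμL : 0 < μ / Lam := by positivity
  have hw : p < pStarStar N lam Lam μ → ∃ (u : ℝ → ℝ) (c : ℝ), IsSolution N lam Lam μ p u ∧
      0 < c ∧ Tendsto (fun r : ℝ => r ^ tauMinus N lam Lam μ * u r) (𝓝[>] 0) (𝓝 c) := by
    intro h
    obtain ⟨hσ, hβ⟩ := pos_and_le_of_le_one_add_two_div hp h.le
    obtain ⟨y, hsol, hlim, -⟩ := exists_isSolution_tauMinus hL hμ' hp hσ hβ
    obtain ⟨c, hc, hyc⟩ := hlim (pos_of_lt_one_add_two_div hp h)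
    exact ⟨_, c, hsol, hc, tendsto_rpow_mul_emden hyc⟩
  refine ⟨fun h => ?_, fun _ => hw, fun h => ?_, fun h => ?_⟩
  · have hσ := (pos_and_le_of_le_one_add_two_div hp h.le).1
    have hβ := pos_of_lt_one_add_two_div hp h
    have hm : 0 < tauMinus N lam Lam μ := pos_of_mul_pos_right (hprod ▸ hμL) hσ.le
    have hα : tauPlus N lam Lam μ < 2 / (p - 1) := by
      rw [lt_div_iff₀ hp1]; linarith
    refine ⟨⟨_, isSolution_explicit hL hμ' hp ?_, tendsto_explicit⟩, ?_, hw ?_⟩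
    · exact mul_pos (by linarith) (by linarith)
    · obtain ⟨y, hsol, c, hc, hyc⟩ := exists_isSolution_tauPlus hL hμ' hp hm hβ
      exact ⟨_, c, hsol, hc, tendsto_rpow_mul_emden hyc⟩
    · refine h.trans ?_
      unfold pStar pStarStar
      gcongr
  · obtain ⟨hσ, hβ⟩ := pos_and_le_of_le_one_add_two_div hp h.le
    have hpe : p - 1 = 2 / tauMinus N lam Lam μ := by rw [h, pStarStar]; ring
    have hβ0 : 2 - tauMinus N lam Lam μ * (p - 1) = 0 := by
      rw [hpe]; field_simp; ring
    have he : 1 / (p - 1) = tauMinus N lam Lam μ / 2 := by rw [hpe, one_div_div]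
    obtain ⟨y, hsol, -, hlim⟩ := exists_isSolution_tauMinus hL hμ' hp hσ hβ
    refine ⟨_, hsol, ?_⟩
    have hlim' := tendsto_rpow_mul_emden (σ := tauMinus N lam Lam μ) (hlim hβ0)
    have hd : 0 < tau N lam Lam - tauMinus N lam Lam μ := by linarith
    have hK : ((p - 1) * (1 / Lam) / (2 * (tau N lam Lam - tauMinus N lam Lam μ)))
        ^ (-(1 / (p - 1))) = constKBar N lam Lam μ := by
      -- Inserting p − 1 = 2/τ⁻ turns the decay constant into the inverse of the base of K̄.
      have hb : (p - 1) * (1 / Lam) / (2 * (tau N lam Lam - tauMinus N lam Lam μ))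
          = (Lam * tauMinus N lam Lam μ * (tau N lam Lam - tauMinus N lam Lam μ))⁻¹ := by
        rw [hpe]; field_simp
      rw [hb, he, Real.rpow_neg (by positivity), Real.inv_rpow (by positivity), inv_inv, constKBar]
    rw [hK, he] at hlim'
    refine hlim'.congr fun r => ?_
    ring
  · have hα0 : 0 < 2 / (p - 1) := by positivity
    have hK : 0 < (2 / (p - 1) - tauPlus N lam Lam μ) * (2 / (p - 1) - tauMinus N lam Lam μ) := by
      -- If τ⁻ > 0, then p > p** puts 2/(p − 1) below both roots. Otherwise τ⁺τ⁻ > 0 makes both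
      -- roots negative (as for N = 1) and both factors positive.
      rcases lt_or_ge 0 (tauMinus N lam Lam μ) with hm | hm
      · have h1 : 2 / tauMinus N lam Lam μ < p - 1 := by unfold pStarStar at h; linarith
        have hα : 2 / (p - 1) < tauMinus N lam Lam μ := by
          rw [div_lt_iff₀ hm] at h1
          rw [div_lt_iff₀ hp1]
          linarith
        exact mul_pos_of_neg_of_neg (by linarith) (by linarith)
      · have hpl : tauPlus N lam Lam μ < 0 := by
          by_contra! hcon
          linarith [mul_nonpos_of_nonneg_of_nonpos hcon hm]
        exact mul_pos (by linarith) (by linarith)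
    exact ⟨_, isSolution_explicit hL hμ' hp hK, fun r _ => mul_comm _ _, tendsto_explicit⟩
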